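/- Let $N,S,T\ge 0$ be integers with $S\le T$, and let $p,q,v_1,v_2$ be complex numbers with $|p|<1$ and $q,v_1,v_2\neq 0$. Put $\theta_p(x)=\prod_{k\ge0}(1-p^kx)(1-p^{k+1}/x)$ and $\theta_p(x_1,\dots,x_r)=\prod_i\theta_p(x_i)$. **Model.** Let $\Omega(N,S,T)$ be the set of families $X=(X(t))_{0\le t\le T}$, $X(t)=(x_1(t)<\dots<x_N(t))$, of $N$ non-intersecting lattice paths from $(0,0),\dots,(0,N-1)$ to $(T,S),\dots,(T,S+N-1)$ with $x_k(t+1)-x_k(t)\in\{0,1\}$ (equivalently, lozenge tilings of the hexagon with sides $N$, $T-S$, $S$). Put $\mathfrak X^{S,t}=\{x\in\mathbb Z:\max(0,t+S-T)\le x\le\min(t+N-1,S+N-1)\}$. The points $(t,x)$ with $x\in\mathfrak X^{S,t}\setminus\{x_1(t),\dots,x_N(t)\}$ are the holes of $X$; they correspond to the horizontal lozenges, and the top vertex of the lozenge of the hole $(t,x)$ has coordinates $(i,j)=(t,\,x+1-t/2)$. The weight $w(X)$ is the product, over all horizontal lozenges, of $$w(i,j)=\frac{(v_1v_2)^{1/2}q^{j-S/2-1/2}\,\theta_p(q^{2j-S-1}v_1v_2)}{\theta_p(q^{j-3i/2-S-1}v_1,\;q^{j-3i/2-S}v_1,\;q^{j+3i/2-1}v_2,\;q^{j+3i/2}v_2)},$$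 with any fixed square roots of $q$ and $v_1v_2$. For an event $A\subseteq\Omega(N,S,T)$ let $\mathrm{Prob}(A)=\sum_{X\in A}w(X)\big/\sum_{X\in\Omega(N,S,T)}w(X)$ (a priori complex), and let $\mathrm{Prob}(A\mid B)=\mathrm{Prob}(A\cap B)/\mathrm{Prob}(B)$ if $\mathrm{Prob}(B)\ne0$. Assume that the parameters are generic: for all integers $m$, $\theta_p(q^m)\ne0$ if $0<m<N+T$; $\theta_p(q^mv_1)\neq0$ if $-2T<m<N-S$; $\theta_p(q^mv_2)\ne0$ if $0<m<N+S+T$; $\theta_p(q^mv_1v_2)\neq0$ if $-T<m<2N$. Let $\varphi_{t,S}(x,y)=q^{-x}\theta_p(q^{x-y},q^{x+y+1-t-S}v_1v_2)$. **Claim.** $X(0),\dots,X(T)$ is a Markov chain: the conditional probability of $X(t+1)=Y$ given $X(0),\dots,X(t)$ equals the one given $X(t)$ alone, and the conditional probability of $X(t-1)=Y$ given $X(t),\dots,X(T)$ equals the one given $X(t)$ alone, whenever both conditioning events have non-zero probability. Its transition and co-transition probabilities are as follows. (1) For every $0\le t<T$ there is a constant $c\ne0$ (depending on $t,N,S,T,p,q,v_1,v_2$,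 but not on $X$, $Y$) such that for all $X,Y\in\mathbb Z^N$ with $\mathrm{Prob}(X(t)=X)\neq0$ and $y_k-x_k\in\{0,1\}$ for all $k$, $$\mathrm{Prob}(X(t+1)=Y\mid X(t)=X)=c\prod_{k<l}\frac{\varphi_{t+1,S}(y_k,y_l)}{\varphi_{t,S}(x_k,x_l)}\prod_{k:\,y_k=x_k+1}w_1(x_k)\prod_{k:\,y_k=x_k}w_0(x_k),$$ $$w_0(x)=\frac{q^{-x-N+1}\theta_p(q^{x+T-t-S},q^{x-T-t-S}v_1,q^{x+t+1}v_2,q^{x+N-t}v_1v_2)}{\theta_p(q^{2x+1-t-S}v_1v_2)},$$ $$w_1(x)=-\frac{q^{-x}\theta_p(q^{x+1-N-S},q^{x-2t-S}v_1,q^{x+T+1}v_2,q^{x-T+1}v_1v_2)}{\theta_p(q^{2x+1-t-S}v_1v_2)}.$$ (2) For every $0<t\le T$ there is a constant $c'\neq0$ (depending on $t,N,S,T,p,q,v_1,v_2$, but not on $X$, $Y$) such that for all $X,Y\in\mathbb Z^N$ with $\mathrm{Prob}(X(t)=X)\ne0$ and $y_k-x_k\in\{0,-1\}$ for all $k$,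 $$\mathrm{Prob}(X(t-1)=Y\mid X(t)=X)=c'\prod_{k<l}\frac{\varphi_{t-1,S}(y_k,y_l)}{\varphi_{t,S}(x_k,x_l)}\prod_{k:\,y_k=x_k-1}w_1'(x_k)\prod_{k:\,y_k=x_k}w_0'(x_k),$$ $$w_0'(x)=-\frac{q^{-x}\theta_p(q^{x-N-t+1},q^{x-t-S+1}v_1,q^{x+t}v_2,q^{x-t-S+1}v_1v_2)}{\theta_p(q^{2x+1-t-S}v_1v_2)},$$ $$w_1'(x)=\frac{q^{-x-N+1}\theta_p(q^{x},q^{x-2t-S+1}v_1,q^{x}v_2,q^{x+N-S}v_1v_2)}{\theta_p(q^{2x+1-t-S}v_1v_2)}.$$ -/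

import Mathlib

open scoped Classical BigOperators

noncomputable section

namespace EllipticTilings

/-- The theta function `θ_p(x) = ∏_{k ≥ 0} (1 - p^k x) (1 - p^(k+1) / x)`. -/
def theta (p x : ℂ) : ℂ := ∏' k : ℕ, (1 - p ^ k * x) * (1 - p ^ (k + 1) / x)

/-- A trajectory: for each time `t = 0, …, T` the positions of the `N` particles. -/
abbrev Trajectory (N T : ℕ) : Type := Fin (T + 1) → Fin N → ℤ

/-- The set of families of `N` non-intersecting lattice paths with steps `0` or `1`, starting at
`(0,0), …, (0,N-1)` and ending at `(T,S), …, (T,S+N-1)`. -/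
def pathFamilies (N S T : ℕ) : Set (Trajectory N T) :=
  {ω | (∀ k : Fin N, ω 0 k = (k : ℤ)) ∧
    (∀ k : Fin N, ω (Fin.last T) k = (S : ℤ) + (k : ℤ)) ∧
    (∀ (t : Fin T) (k : Fin N),
      ω t.succ k = ω t.castSucc k ∨ ω t.succ k = ω t.castSucc k + 1) ∧
    (∀ t : Fin (T + 1), StrictMono (ω t))}

theorem pathFamilies_finite (N S T : ℕ) : (pathFamilies N S T).Finite := by
  have key : pathFamilies N S T ⊆
      Set.pi Set.univ (fun t : Fin (T + 1) => Set.pi Set.univ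
        (fun k : Fin N => Set.Icc (k : ℤ) ((k : ℤ) + (t : ℕ)))) := by
    rintro ω ⟨h0, -, hstep, -⟩ t - k -
    induction t using Fin.induction with
    | zero => simp [h0 k]
    | succ i ih =>
      obtain ⟨h1, h2⟩ := ih
      simp only [Fin.val_castSucc] at h2
      rcases hstep i k with h | h <;>
      · refine ⟨?_, ?_⟩
        · rw [h]; linarith
        · rw [h, Fin.val_succ]; push_cast; linarith
  exact (Set.Finite.pi' fun _ => Set.Finite.pi' fun _ => Set.finite_Icc _ _).subset
    (fun ω hω t k => key hω t (Set.mem_univ _) k (Set.mem_univ _))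

/-- `Ω(N,S,T)` as a finite set. -/
def Omega (N S T : ℕ) : Finset (Trajectory N T) := (pathFamilies_finite N S T).toFinset

/-- All possible particle positions on the vertical line at `t`. -/
def sites (N S T : ℕ) (t : ℤ) : Finset ℤ :=
  Finset.Icc (max 0 (t + S - T)) (min (t + N - 1) (S + N - 1))

/-- The parameters of the model: the integers `N, S, T` and the complex numbers
`p, v₁, v₂`, together with a square root `rq` of `q` and a square root `rv` of `v₁ v₂`. -/
structure Params where
  N : ℕ
  S : ℕ
  T : ℕ
  p : ℂ
  q : ℂ
  v₁ : ℂ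
  v₂ : ℂ
  rq : ℂ
  rv : ℂ

namespace Params

variable (P : Params)

/-- The weight of a horizontal lozenge whose top vertex has coordinates `(i, j)`, `j = J / 2`,
`(v₁v₂)^(1/2) q^(j-S/2-1/2) θ(q^(2j-S-1) v₁v₂)` divided by
`θ(q^(j-3i/2-S-1) v₁) θ(q^(j-3i/2-S) v₁) θ(q^(j+3i/2-1) v₂) θ(q^(j+3i/2) v₂)`.
Powers of `q` with possibly half-integral exponents `e` are written `rq ^ (2 e)`. -/
def lozengeWeight (i J : ℤ) : ℂ :=
  P.rv * P.rq ^ (J - P.S - 1) * theta P.p (P.rq ^ (2 * J - 2 * P.S - 2) * (P.v₁ * P.v₂)) /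
    (theta P.p (P.rq ^ (J - 3 * i - 2 * P.S - 2) * P.v₁) *
      theta P.p (P.rq ^ (J - 3 * i - 2 * P.S) * P.v₁) *
      theta P.p (P.rq ^ (J + 3 * i - 2) * P.v₂) *
      theta P.p (P.rq ^ (J + 3 * i) * P.v₂))

/-- The holes of a configuration on the line `t`: the sites not occupied by a particle. -/
def holes (t : ℤ) (X : Fin P.N → ℤ) : Finset ℤ :=
  sites P.N P.S P.T t \ Finset.univ.image X

/-- The weight of a tiling, the product of the weights of its horizontal lozenges.  These are the
holes of the path family: the hole `x` on the line `t` occupies the unit segment from `x` to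
`x + 1` in the coordinates `(t, x)`.  As `(i, j) = (t, x - t/2)`, its top vertex has `i = t`,
`2 j = 2 (x + 1) - t`. -/
def tilingWeight (ω : Trajectory P.N P.T) : ℂ :=
  ∏ t : Fin (P.T + 1), ∏ x ∈ P.holes (t : ℕ) (ω t),
    P.lozengeWeight (t : ℕ) (2 * (x + 1) - (t : ℕ))

/-- The (a priori complex) probability of an event: its total weight divided by the total weight
of all tilings. -/
def prob (A : Set (Trajectory P.N P.T)) : ℂ :=
  (∑ ω ∈ Omega P.N P.S P.T with ω ∈ A, P.tilingWeight ω) /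
    ∑ ω ∈ Omega P.N P.S P.T, P.tilingWeight ω

/-- Conditional probability of `A` given `B` (meaningful when `prob B ≠ 0`). -/
def condProb (A B : Set (Trajectory P.N P.T)) : ℂ := P.prob (A ∩ B) / P.prob B

/-- The event `X(t) = X`. -/
def atTime (t : Fin (P.T + 1)) (X : Fin P.N → ℤ) : Set (Trajectory P.N P.T) :=
  {ω | ω t = X}

/-- The event that `X(s) = H(s)` for all times `s ≤ t`. -/
def past (t : Fin (P.T + 1)) (H : Trajectory P.N P.T) : Set (Trajectory P.N P.T) :=
  {ω | ∀ s, s ≤ t → ω s = H s}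

/-- The event that `X(s) = H(s)` for all times `s ≥ t`. -/
def future (t : Fin (P.T + 1)) (H : Trajectory P.N P.T) : Set (Trajectory P.N P.T) :=
  {ω | ∀ s, t ≤ s → ω s = H s}

/-- `φ_{t,S}(x,y) = q^(-x) θ(q^(x-y)) θ(q^(x+y+1-t-S) v₁ v₂)`. -/
def phi (t x y : ℤ) : ℂ :=
  P.q ^ (-x) * theta P.p (P.q ^ (x - y)) *
    theta P.p (P.q ^ (x + y + 1 - t - P.S) * (P.v₁ * P.v₂))

/-- The ratio of elliptic Vandermonde products
`∏_{k<l} φ_{t',S}(y_k,y_l) / φ_{t,S}(x_k,x_l)`. -/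
def vandermondeRatio (t' t : ℤ) (Y X : Fin P.N → ℤ) : ℂ :=
  ∏ k : Fin P.N, ∏ l ∈ Finset.Ioi k, P.phi t' (Y k) (Y l) / P.phi t (X k) (X l)

/-- Weight of a particle staying put in the transition `t → t + 1`. -/
def w₀ (t x : ℤ) : ℂ :=
  P.q ^ (-x - P.N + 1) *
      (theta P.p (P.q ^ (x + P.T - t - P.S)) * theta P.p (P.q ^ (x - P.T - t - P.S) * P.v₁) *
        theta P.p (P.q ^ (x + t + 1) * P.v₂) *
        theta P.p (P.q ^ (x + P.N - t) * (P.v₁ * P.v₂))) /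
    theta P.p (P.q ^ (2 * x + 1 - t - P.S) * (P.v₁ * P.v₂))

/-- Weight of a particle jumping up by one in the transition `t → t + 1`. -/
def w₁ (t x : ℤ) : ℂ :=
  -(P.q ^ (-x) *
      (theta P.p (P.q ^ (x + 1 - P.N - P.S)) * theta P.p (P.q ^ (x - 2 * t - P.S) * P.v₁) *
        theta P.p (P.q ^ (x + P.T + 1) * P.v₂) *
        theta P.p (P.q ^ (x - P.T + 1) * (P.v₁ * P.v₂))) /
    theta P.p (P.q ^ (2 * x + 1 - t - P.S) * (P.v₁ * P.v₂)))

/-- Weight of a particle staying put in the transition `t → t - 1`. -/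
def w₀' (t x : ℤ) : ℂ :=
  -(P.q ^ (-x) *
      (theta P.p (P.q ^ (x - P.N - t + 1)) * theta P.p (P.q ^ (x - t - P.S + 1) * P.v₁) *
        theta P.p (P.q ^ (x + t) * P.v₂) *
        theta P.p (P.q ^ (x - t - P.S + 1) * (P.v₁ * P.v₂))) /
    theta P.p (P.q ^ (2 * x + 1 - t - P.S) * (P.v₁ * P.v₂)))

/-- Weight of a particle jumping down by one in the transition `t → t - 1`. -/
def w₁' (t x : ℤ) : ℂ :=
  P.q ^ (-x - P.N + 1) *
      (theta P.p (P.q ^ x) * theta P.p (P.q ^ (x - 2 * t - P.S + 1) * P.v₁) *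
        theta P.p (P.q ^ x * P.v₂) *
        theta P.p (P.q ^ (x + P.N - P.S) * (P.v₁ * P.v₂))) /
    theta P.p (P.q ^ (2 * x + 1 - t - P.S) * (P.v₁ * P.v₂))

/-- The standing assumptions: `0 ≤ S ≤ T`, `|p| < 1`, non-zero parameters, a choice of square
roots, and genericity, i.e. none of the theta functions below vanishes.  For a hexagon with
positive side lengths the conditions on `v₁` and `v₂` say exactly that the denominators of the
weights of the sites of the hexagon do not vanish. -/
structure Generic : Prop where
  S_le_T : P.S ≤ P.T
  norm_p : ‖P.p‖ < 1
  q_ne : P.q ≠ 0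
  v₁_ne : P.v₁ ≠ 0
  v₂_ne : P.v₂ ≠ 0
  rq_sq : P.rq ^ 2 = P.q
  rv_sq : P.rv ^ 2 = P.v₁ * P.v₂
  theta_q : ∀ m : ℤ, 0 < m → m < (P.N : ℤ) + P.T → theta P.p (P.q ^ m) ≠ 0
  theta_v₁ : ∀ m : ℤ, -(2 * (P.T : ℤ)) < m → m < (P.N : ℤ) - P.S →
    theta P.p (P.q ^ m * P.v₁) ≠ 0
  theta_v₂ : ∀ m : ℤ, 0 < m → m < (P.N : ℤ) + P.S + P.T → theta P.p (P.q ^ m * P.v₂) ≠ 0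
  theta_v₁v₂ : ∀ m : ℤ, -(P.T : ℤ) < m → m < 2 * (P.N : ℤ) →
    theta P.p (P.q ^ m * (P.v₁ * P.v₂)) ≠ 0

end Params

end EllipticTilings

end

noncomputable section

namespace EllipticTilings

open Filter Topology

/-! ### The Jacobi triple product -/

/-! The weight of a path family is the weight up to a line `t` times the weight of what follows, and
the latter depends on the past only through the configuration at time `t`. Summing over
continuations gives `futureWeight`, and both conditional probabilities become the weight of one step
times a quotient of two values of `futureWeight`. This is the Markov property; the transition
formula requires a closed form for `futureWeight`.

That closed form is `Generic.lineWeight_mul_futureWeight`: on configurations, the weight of a line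
times the weight of its future is a constant times the elliptic Vandermonde product times a product
over particles of `arrivalWeight`. It is proved backwards from time `T`, where only one
configuration exists. The induction step has three ingredients. First, the sum over all jumps of the
one-particle weights `w₀`, `w₁` times the Vandermonde product on the next line is a multiple `κ` of
the Vandermonde product on the present line (`sum_vandermonde`). Second, the arrival weights absorb
`w₀` and `w₁`, leaving a factor that depends only on the site of departure, and this factor is
proportional to lozenge weight times arrival weight (`departureWeight_eq`). Third, a product over
holes is a constant divided by the product over particles.

The summation formula has a one-variable origin. In a multiplicative coordinate `z` a jump is `z ↦ s
z` and a stay is `z ↦ z / s` with `s ^ 2 = q`, and the two weights are values of one function `W` at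
`z` and `1 / z`, up to a common factor. The operator `f ↦ W(z) f(s z) + W(1 / z) f(z / s)` preserves
the forms of degree `N - 1` in two functions `F₀`, `F₁`. The Vandermonde product is the determinant
of the `N` monomials of that degree, so applying the operator to every row multiplies it by a
constant.

The theta function input is that `θ(c z) θ(c / z)` is `c` times a 2 by 2 minor in `F₀`, `F₁`. The
Plücker relation for such minors is the Weierstrass addition formula. The minors come from the
Jacobi triple product, by splitting a double series according to parity.

The co-transition formula follows from the transition formula by rotating the hexagon by 180
degrees, which maps the model to one with other generic `v₁`, `v₂`. -/

/-- The triangular numbers `j (j - 1) / 2`, for integers `j`. -/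
def tri (j : ℤ) : ℤ := j * (j - 1) / 2

theorem two_mul_tri (j : ℤ) : 2 * tri j = j * (j - 1) :=
  Int.mul_ediv_cancel' (Int.even_mul_pred_self j).two_dvd

theorem tri_add_one (j : ℤ) : tri (j + 1) = tri j + j := by
  have h1 := two_mul_tri j
  have h2 := two_mul_tri (j + 1)
  linarith [h1, h2, show (j + 1) * (j + 1 - 1) = j * (j - 1) + 2 * j by ring]

theorem tri_zero : tri 0 = 0 := by simp [tri]

/-- The reciprocal `1 / ((1 - p) ⋯ (1 - p ^ m))` of a `p`-factorial, which is zero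
for negative integers `m`. -/
def invPFactorial (p : ℂ) (m : ℤ) : ℂ :=
  if m < 0 then 0 else (∏ i ∈ Finset.range m.toNat, (1 - p ^ (i + 1)))⁻¹

theorem one_sub_pow_ne_zero {p : ℂ} (hp : ‖p‖ < 1) (i : ℕ) : 1 - p ^ (i + 1) ≠ 0 := by
  intro h
  have h1 : ‖p ^ (i + 1)‖ = 1 := by rw [← sub_eq_zero.mp h]; simp
  rw [norm_pow] at h1
  exact absurd h1 (pow_lt_one₀ (norm_nonneg p) hp (by omega)).ne

/-- The value zero at negative integers makes the recursion valid for every integer: at `m = 0` both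
sides vanish because `1 - p ^ 0 = 0`. No boundary terms then need separate treatment. -/
theorem invPFactorial_sub_one {p : ℂ} (hp : ‖p‖ < 1) (m : ℤ) :
    invPFactorial p (m - 1) = (1 - p ^ m) * invPFactorial p m := by
  rcases lt_trichotomy m 0 with h | h | h
  · simp [invPFactorial, h, show m - 1 < 0 by omega]
  · simp [invPFactorial, h]
  · obtain ⟨n, rfl⟩ : ∃ n : ℕ, m = n + 1 := ⟨(m - 1).toNat, by omega⟩
    have h1 : ¬ ((n : ℤ) < 0) := by omega
    have h2 : ¬ ((n : ℤ) + 1 < 0) := by omega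
    have h3 : ((n : ℤ) + 1).toNat = n + 1 := by omega
    have h4 := one_sub_pow_ne_zero hp n
    have h5 : p ^ ((n : ℤ) + 1) = p ^ (n + 1) := by exact_mod_cast rfl
    simp only [invPFactorial, add_sub_cancel_right, h1, h2, if_false, h3, Int.toNat_natCast,
      Finset.prod_range_succ, h5, mul_inv]
    field_simp

/-- The summand of index `j` in the finite form of the triple product. -/
def finiteTripleTerm (p x : ℂ) (n : ℕ) (j : ℤ) : ℂ :=
  (-1) ^ j * p ^ tri j * (invPFactorial p (n + j) * invPFactorial p (n - j)) * x ^ j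

/-- Coefficient form of multiplication by the next factor of the product, `(1 - p ^ n x)(1 - p ^ (n
+ 1) / x) = 1 + p ^ (2n + 1) - p ^ n x - p ^ (n + 1) / x`. The factors on the left account for the
change of normalization from `2n` to `2n + 2`. -/
theorem finiteTripleTerm_succ {p x : ℂ} (hp : ‖p‖ < 1) (hp0 : p ≠ 0) (hx : x ≠ 0) (n : ℕ)
    (j : ℤ) :
    (1 - p ^ (2 * n + 1)) * (1 - p ^ (2 * n + 2)) * finiteTripleTerm p x (n + 1) j =
      (1 + p ^ (2 * n + 1)) * finiteTripleTerm p x n j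
        - p ^ n * x * finiteTripleTerm p x n (j - 1)
        - p ^ (n + 1) / x * finiteTripleTerm p x n (j + 1) := by
  have a1 := invPFactorial_sub_one hp (n + 1 + j)
  have a2 := invPFactorial_sub_one hp (n + 1 + j - 1)
  have b1 := invPFactorial_sub_one hp (n + 1 - j)
  have b2 := invPFactorial_sub_one hp (n + 1 - j - 1)
  have t1 : tri (j - 1) = tri j - j + 1 := by
    have := tri_add_one (j - 1)
    rw [sub_add_cancel] at this
    omega
  have t2 := tri_add_one j
  have e1 : (n : ℤ) + j = n + 1 + j - 1 := by ring
  have e2 : (n : ℤ) + (j - 1) = n + 1 + j - 1 - 1 := by ring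
  have e3 : (n : ℤ) - j = n + 1 - j - 1 := by ring
  have e4 : (n : ℤ) - (j + 1) = n + 1 - j - 1 - 1 := by ring
  have e5 : (n : ℤ) + (j + 1) = n + 1 + j := by ring
  have e6 : (n : ℤ) - (j - 1) = n + 1 - j := by ring
  have n1 : (-1 : ℂ) ^ (j - 1) = -(-1) ^ j := by
    rw [zpow_sub_one₀ (by norm_num)]; ring
  have n2 : (-1 : ℂ) ^ (j + 1) = -(-1) ^ j := by
    rw [zpow_add_one₀ (by norm_num)]; ring
  have x1 : x * x ^ (j - 1) = x ^ j := by
    rw [zpow_sub_one₀ hx]; field_simp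
  have x2 : x ^ (j + 1) / x = x ^ j := by
    rw [zpow_add_one₀ hx]; field_simp
  unfold finiteTripleTerm
  rw [e2, e4, e5, e6, e1, e3, a2, a1, b2, b1, n1, n2, t1, t2]
  push_cast
  set R := invPFactorial p (n + 1 + j)
  set R' := invPFactorial p (n + 1 - j)
  have P1 : p ^ ((n : ℤ) + 1 + j) = p ^ n * p * p ^ j := by
    rw [zpow_add₀ hp0, zpow_add_one₀ hp0, zpow_natCast]
  have P2 : p ^ ((n : ℤ) + 1 - j) = p ^ n * p / p ^ j := by
    rw [zpow_sub₀ hp0, zpow_add_one₀ hp0, zpow_natCast]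
  have P3 : p ^ ((n : ℤ) + 1 + j - 1) = p ^ n * p ^ j := by
    rw [zpow_sub_one₀ hp0, P1]; field_simp
  have P4 : p ^ ((n : ℤ) + 1 - j - 1) = p ^ n / p ^ j := by
    rw [zpow_sub_one₀ hp0, P2]; field_simp
  have P5 : p ^ (tri j - j + 1) = p ^ tri j / p ^ j * p := by
    rw [zpow_add_one₀ hp0, zpow_sub₀ hp0]
  have P6 : p ^ (tri j + j) = p ^ tri j * p ^ j := zpow_add₀ hp0 _ _
  have P7 : p ^ (2 * n + 1) = (p ^ n) ^ 2 * p := by ring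
  have P8 : p ^ (2 * n + 2) = (p ^ n) ^ 2 * p ^ 2 := by ring
  have P9 : p ^ (n + 1) = p ^ n * p := pow_succ _ _
  rw [P1, P2, P3, P4, P5, P6, P7, P8, P9]
  have hj : p ^ j ≠ 0 := zpow_ne_zero _ hp0
  rw [show ∀ u v w : ℂ, p ^ n * x * (u * v * w * x ^ (j - 1)) =
    p ^ n * u * v * w * (x * x ^ (j - 1)) by intros; ring, x1,
    show ∀ u v w : ℂ, p ^ n * p / x * (u * v * w * x ^ (j + 1)) =
    p ^ n * p * u * v * w * (x ^ (j + 1) / x) by intros; ring, x2]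
  generalize p ^ j = J at *
  generalize p ^ n = Q
  field_simp
  ring

/-- The finite form of the Jacobi triple product. -/
theorem hasSum_finiteTripleTerm {p x : ℂ} (hp : ‖p‖ < 1) (hp0 : p ≠ 0) (hx : x ≠ 0) (n : ℕ) :
    HasSum (finiteTripleTerm p x n)
      (invPFactorial p (2 * n) *
        ∏ k ∈ Finset.range n, (1 - p ^ k * x) * (1 - p ^ (k + 1) / x)) := by
  induction n with
  | zero =>
    have : finiteTripleTerm p x 0 = fun j => if j = 0 then 1 else 0 := by
      funext j
      rcases lt_trichotomy j 0 with h | h | h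
      · simp [finiteTripleTerm, invPFactorial, h, h.ne]
      · simp [finiteTripleTerm, invPFactorial, h, tri_zero]
      · simp [finiteTripleTerm, invPFactorial, h, h.ne']
    rw [this]
    simpa [invPFactorial] using hasSum_ite_eq (0 : ℤ) (1 : ℂ)
  | succ n ih =>
    -- Sum the recursion over `j`; the shifted terms have the same sum as the unshifted ones.
    have h1 := (Equiv.subRight (1 : ℤ)).hasSum_iff.mpr ih
    have h2 := (Equiv.addRight (1 : ℤ)).hasSum_iff.mpr ih
    have h3 := ((ih.mul_left (1 + p ^ (2 * n + 1))).sub (h1.mul_left (p ^ n * x))).sub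
      (h2.mul_left (p ^ (n + 1) / x))
    have c1 := one_sub_pow_ne_zero hp (2 * n)
    have c2 := one_sub_pow_ne_zero hp (2 * n + 1)
    have h4 := h3.mul_left (((1 - p ^ (2 * n + 1)) * (1 - p ^ (2 * n + 2)))⁻¹)
    have hf : finiteTripleTerm p x (n + 1) = fun j =>
        ((1 - p ^ (2 * n + 1)) * (1 - p ^ (2 * n + 2)))⁻¹ *
          ((1 + p ^ (2 * n + 1)) * finiteTripleTerm p x n j
            - p ^ n * x * (finiteTripleTerm p x n ∘ Equiv.subRight (1 : ℤ)) j
            - p ^ (n + 1) / x * (finiteTripleTerm p x n ∘ Equiv.addRight (1 : ℤ)) j) := by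
      funext j
      have := finiteTripleTerm_succ hp hp0 hx n j
      simp only [Function.comp_apply, Equiv.subRight_apply, Equiv.coe_addRight]
      rw [← this]
      field_simp
    rw [hf]
    refine (congrArg (fun a => HasSum _ a) ?_ : _ = _).mp h4
    · have q1 := invPFactorial_sub_one hp (2 * n + 1)
      have q2 := invPFactorial_sub_one hp (2 * n + 2)
      rw [show (2 * n + 2 : ℤ) - 1 = 2 * n + 1 by ring] at q2
      rw [add_sub_cancel_right, q2] at q1
      rw [Finset.prod_range_succ]
      push_cast
      rw [show 2 * ((n : ℤ) + 1) = 2 * n + 2 by ring, q1]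
      have z1 : p ^ (2 * (n : ℤ) + 1) = p ^ (2 * n + 1) := by exact_mod_cast rfl
      have z2 : p ^ (2 * (n : ℤ) + 2) = p ^ (2 * n + 2) := by exact_mod_cast rfl
      rw [z1, z2]
      field_simp
      ring_nf

theorem summable_tri_nat {p x : ℂ} (hp : ‖p‖ < 1) (hp0 : p ≠ 0) (hx : x ≠ 0) :
    Summable fun n : ℕ => ‖p ^ tri n * x ^ n‖ := by
  refine Summable.norm (summable_of_ratio_test_tendsto_lt_one (l := 0) one_pos
    (Eventually.of_forall fun n => mul_ne_zero (zpow_ne_zero _ hp0) (pow_ne_zero _ hx)) ?_)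
  have h : ∀ n : ℕ, ‖p ^ tri (n + 1 : ℕ) * x ^ (n + 1)‖ / ‖p ^ tri n * x ^ n‖ =
      ‖p‖ ^ n * ‖x‖ := by
    intro n
    rw [← norm_div, ← norm_pow, ← norm_mul]
    push_cast
    rw [tri_add_one, zpow_add₀ hp0, zpow_natCast, pow_succ]
    congr 1
    have := zpow_ne_zero (tri n) hp0
    field_simp
  simp only [h]
  simpa using (tendsto_pow_atTop_nhds_zero_of_lt_one (norm_nonneg p) hp).mul_const ‖x‖

theorem summable_norm_tri {p x : ℂ} (hp : ‖p‖ < 1) (hp0 : p ≠ 0) (hx : x ≠ 0) :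
    Summable fun j : ℤ => ‖(-1) ^ j * p ^ tri j * x ^ j‖ := by
  refine Summable.of_nat_of_neg ?_ ?_
  · simpa using summable_tri_nat hp hp0 hx
  -- Since `tri (-n) = tri n + n`, the negative half of the series is the positive half at `p / x`.
  · have h := summable_tri_nat hp hp0 (mul_ne_zero hp0 (inv_ne_zero hx))
    refine h.congr fun n => ?_
    have ht : tri (-n) = tri n + n := by
      have h1 := two_mul_tri n
      have h2 := two_mul_tri (-n)
      linarith [show (-(n : ℤ)) * (-n - 1) = n * (n - 1) + 2 * n by ring]
    rw [ht, zpow_add₀ hp0, mul_pow, zpow_natCast, inv_pow, zpow_neg, zpow_neg, zpow_natCast,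
      zpow_natCast]
    simp [mul_assoc]

theorem tendsto_invPFactorial {p : ℂ} (hp : ‖p‖ < 1) :
    ∃ C : ℂ, C ≠ 0 ∧ Tendsto (fun n : ℕ => invPFactorial p n) atTop (𝓝 C) := by
  have hs : Summable fun i : ℕ => ‖-p ^ (i + 1)‖ := by
    simp only [norm_neg, norm_pow]
    exact (summable_nat_add_iff 1).mpr (summable_geometric_of_lt_one (norm_nonneg p) hp)
  have hm := (multipliable_one_add_of_summable hs).hasProd.tendsto_prod_nat
  have hne := tprod_one_add_ne_zero_of_summable
    (fun i => by simpa [← sub_eq_add_neg] using one_sub_pow_ne_zero hp i) hs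
  refine ⟨_, inv_ne_zero hne, (hm.inv₀ hne).congr fun n => ?_⟩
  simp [invPFactorial, sub_eq_add_neg]

theorem multipliable_theta {p : ℂ} (hp : ‖p‖ < 1) (x : ℂ) :
    Multipliable fun k : ℕ => (1 - p ^ k * x) * (1 - p ^ (k + 1) / x) := by
  have hg := summable_geometric_of_lt_one (norm_nonneg p) hp
  have h1 : Multipliable fun k : ℕ => 1 + -(p ^ k * x) := by
    refine multipliable_one_add_of_summable ?_
    simpa using hg.mul_right ‖x‖
  have h2 : Multipliable fun k : ℕ => 1 + -(p ^ (k + 1) / x) := by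
    refine multipliable_one_add_of_summable ?_
    simpa using ((summable_nat_add_iff 1).mpr hg).div_const ‖x‖
  simpa [sub_eq_add_neg] using h1.mul h2

/-- The Jacobi triple product, up to the value of the constant. -/
theorem theta_eq_tsum {p : ℂ} (hp : ‖p‖ < 1) (hp0 : p ≠ 0) :
    ∃ C : ℂ, C ≠ 0 ∧ ∀ x : ℂ, x ≠ 0 →
      theta p x = C * ∑' j : ℤ, (-1) ^ j * p ^ tri j * x ^ j := by
  obtain ⟨C, hCne, hC⟩ := tendsto_invPFactorial hp
  refine ⟨C, hCne, fun x hx => ?_⟩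
  -- A uniform bound on the reciprocal factorials provides the dominating series for the limit `n →
  -- ∞`.
  obtain ⟨M, hM⟩ : ∃ M, ∀ m : ℤ, ‖invPFactorial p m‖ ≤ M := by
    obtain ⟨M, hM⟩ := (hC.norm).bddAbove_range
    refine ⟨max M 0, fun m => ?_⟩
    rcases lt_or_ge m 0 with h | h
    · simp [invPFactorial, h]
    · obtain ⟨n, rfl⟩ := Int.eq_ofNat_of_zero_le h
      exact (hM ⟨n, rfl⟩).trans (le_max_left _ _)
  have hM0 : 0 ≤ M := (norm_nonneg _).trans (hM 0)
  have htop : Tendsto (fun n : ℕ => ∑' j, finiteTripleTerm p x n j) atTop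
      (𝓝 (∑' j : ℤ, (-1) ^ j * p ^ tri j * (C * C) * x ^ j)) := by
    refine tendsto_tsum_of_dominated_convergence
      (bound := fun j : ℤ => M * M * ‖(-1) ^ j * p ^ tri j * x ^ j‖)
      ((summable_norm_tri hp hp0 hx).mul_left _) (fun j => ?_) (Eventually.of_forall fun n j => ?_)
    · have s1 : Tendsto (fun n : ℕ => invPFactorial p (n + j)) atTop (𝓝 C) := by
        have : Tendsto (fun n : ℕ => ((n : ℤ) + j).toNat) atTop atTop :=
          tendsto_atTop.mpr fun b => (eventually_ge_atTop (b + j.natAbs)).mono fun n hn => by omega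
        refine (hC.comp this).congr' ((eventually_ge_atTop j.natAbs).mono fun n hn => ?_)
        simp only [Function.comp_apply]
        rw [Int.toNat_of_nonneg (by omega)]
      have s2 : Tendsto (fun n : ℕ => invPFactorial p (n - j)) atTop (𝓝 C) := by
        have : Tendsto (fun n : ℕ => ((n : ℤ) - j).toNat) atTop atTop :=
          tendsto_atTop.mpr fun b => (eventually_ge_atTop (b + j.natAbs)).mono fun n hn => by omega
        refine (hC.comp this).congr' ((eventually_ge_atTop j.natAbs).mono fun n hn => ?_)
        simp only [Function.comp_apply]
        rw [Int.toNat_of_nonneg (by omega)]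
      exact ((s1.mul s2).const_mul _).mul_const _
    · have : finiteTripleTerm p x n j =
          invPFactorial p (n + j) * invPFactorial p (n - j) * ((-1) ^ j * p ^ tri j * x ^ j) := by
        unfold finiteTripleTerm; ring
      rw [this, norm_mul, norm_mul]
      gcongr
      · exact hM _
      · exact hM _
  -- The prefactor of index `2n` also tends to `C`, whereas each summand tends to `C * C` times a
  -- term of the series; one factor `C` cancels at the end.
  have hprod : Tendsto (fun n : ℕ => ∑' j, finiteTripleTerm p x n j) atTop
      (𝓝 (C * theta p x)) := by
    have h2 : Tendsto (fun n : ℕ => invPFactorial p (2 * n)) atTop (𝓝 C) := by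
      have : Tendsto (fun n : ℕ => 2 * n) atTop atTop :=
        tendsto_atTop.mpr fun b => (eventually_ge_atTop b).mono fun n hn => by omega
      exact (hC.comp this).congr fun n => by simp
    refine (h2.mul (multipliable_theta hp x).hasProd.tendsto_prod_nat).congr fun n => ?_
    exact (hasSum_finiteTripleTerm hp hp0 hx n).tsum_eq.symm
  have := tendsto_nhds_unique hprod htop
  refine mul_left_cancel₀ hCne (this.trans ?_)
  rw [← tsum_mul_left, ← tsum_mul_left]
  refine tsum_congr fun j => ?_
  ring

/-! ### The addition formula for theta functions -/

theorem theta_zero_left (x : ℂ) : theta 0 x = 1 - x := by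
  unfold theta
  rw [tprod_eq_prod (s := {0})]
  · simp
  · intro k hk
    simp_all

/-- The inversion formula for theta functions. -/
theorem theta_inv {p x : ℂ} (hp : ‖p‖ < 1) (hx : x ≠ 0) : theta p x⁻¹ = -theta p x / x := by
  -- The series has negative powers of `x` and needs `p ≠ 0`; for `p = 0` the product degenerates to
  -- `1 - x`.
  by_cases hp0 : p = 0
  · subst hp0
    rw [theta_zero_left, theta_zero_left]
    field_simp
    ring
  obtain ⟨C, -, hC⟩ := theta_eq_tsum hp hp0
  rw [hC _ (inv_ne_zero hx), hC _ hx, ← (Equiv.subLeft (1 : ℤ)).tsum_eq]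
  rw [neg_div, mul_div_assoc, ← mul_neg, ← tsum_div_const, ← tsum_neg]
  congr 2
  funext j
  -- The substitution `j ↦ 1 - j` fixes the triangular number and flips the sign.
  have ht : tri (1 - j) = tri j := by
    have h1 := two_mul_tri j
    have h2 := two_mul_tri (1 - j)
    linarith [show (1 - j) * (1 - j - 1) = j * (j - 1) by ring]
  have hs : (-1 : ℂ) ^ (1 - j) = -(-1) ^ j := by
    rw [zpow_sub₀ (by norm_num)]
    rcases Int.even_or_odd j with h | h
    · simp [h.neg_one_zpow]
    · simp [h.neg_one_zpow]
  rw [Equiv.subLeft_apply, ht, hs, inv_zpow', neg_sub, zpow_sub_one₀ hx]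
  field_simp

theorem theta_one {p : ℂ} (hp : ‖p‖ < 1) : theta p 1 = 0 := by
  have := theta_inv hp one_ne_zero
  rw [inv_one, div_one] at this
  exact self_eq_neg.mp this

/-- Pairs of integers, sorted by the parity of their sum. -/
def parityEquiv : (ℤ × ℤ) ⊕ (ℤ × ℤ) ≃ ℤ × ℤ where
  toFun := Sum.elim (fun a => (a.1 + a.2, a.1 - a.2)) (fun a => (a.1 + a.2 + 1, a.1 - a.2))
  invFun b := if (b.1 - b.2) % 2 = 0 then .inl ((b.1 + b.2) / 2, (b.1 - b.2) / 2)
    else .inr ((b.1 + b.2 - 1) / 2, (b.1 - b.2 - 1) / 2)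
  left_inv := by
    rintro (⟨r, s⟩ | ⟨r, s⟩)
    · change (if (r + s - (r - s)) % 2 = 0 then _ else _) = _
      rw [if_pos (by omega)]
      exact congrArg Sum.inl (Prod.ext (by dsimp; omega) (by dsimp; omega))
    · change (if (r + s + 1 - (r - s)) % 2 = 0 then _ else _) = _
      rw [if_neg (by omega)]
      exact congrArg Sum.inr (Prod.ext (by dsimp; omega) (by dsimp; omega))
  right_inv := by
    rintro ⟨m, n⟩
    dsimp only
    split_ifs with h
    · simp only [Sum.elim_inl]
      congr 1 <;> omega
    · simp only [Sum.elim_inr]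
      congr 1 <;> omega

theorem summable_norm_tri' {p x : ℂ} (hp : ‖p‖ < 1) (hp0 : p ≠ 0) (hx : x ≠ 0) :
    Summable fun j : ℤ => ‖p ^ tri j * x ^ j‖ := by
  simpa using summable_norm_tri hp hp0 hx

/-- Products `θ(cz) θ(c/z)` are the minors of two even functions `F₀`, `F₁`. -/
theorem exists_theta_mul_theta {p : ℂ} (hp : ‖p‖ < 1) :
    ∃ F₀ F₁ : ℂ → ℂ, ∀ c z : ℂ, c ≠ 0 → z ≠ 0 →
      theta p (c * z) * theta p (c / z) = c * (F₁ c * F₀ z - F₀ c * F₁ z) := by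
  by_cases hp0 : p = 0
  · subst hp0
    refine ⟨fun _ => 1, fun z => z + 1 / z, fun c z hc hz => ?_⟩
    rw [theta_zero_left, theta_zero_left]
    field_simp
    ring
  obtain ⟨C, -, hC⟩ := theta_eq_tsum hp hp0
  let g : ℂ → ℂ := fun x => ∑' j : ℤ, (p ^ 2) ^ tri j * x ^ j
  have hp2 : ‖p ^ 2‖ < 1 := by
    rw [norm_pow]; exact pow_lt_one₀ (norm_nonneg _) hp two_ne_zero
  have hp20 : p ^ 2 ≠ 0 := pow_ne_zero _ hp0
  have hg : ∀ c z : ℂ, c ≠ 0 → z ≠ 0 →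
      HasSum (fun a : ℤ × ℤ => (p ^ 2) ^ tri a.1 * c ^ a.1 * ((p ^ 2) ^ tri a.2 * z ^ a.2))
        (g c * g z) := by
    intro c z hc hz
    have h1 := summable_norm_tri' hp2 hp20 hc
    have h2 := summable_norm_tri' hp2 hp20 hz
    rw [tsum_mul_tsum_of_summable_norm h1 h2]
    exact (summable_mul_of_summable_norm h1 h2).hasSum
  -- In the double series put the two indices equal to `r + s`, `r - s` (even sum) or `r + s + 1`,
  -- `r - s` (odd sum). The variables `c` and `z` then separate, and each parity class is a product
  -- of two theta series with nome `p ^ 2`.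
  have hmul : ∀ c z : ℂ, c ≠ 0 → z ≠ 0 → theta p (c * z) * theta p (c / z) =
      C ^ 2 * (g (c ^ 2) * g (p * z ^ 2) - c * z * (g (p * c ^ 2) * g (p ^ 2 * z ^ 2))) := by
    intro c z hc hz
    have hcz := mul_ne_zero hc hz
    have hcz' := div_ne_zero hc hz
    have h1 := summable_norm_tri hp hp0 hcz
    have h2 := summable_norm_tri hp hp0 hcz'
    rw [hC _ hcz, hC _ hcz', show ∀ u v : ℂ, C * u * (C * v) = C ^ 2 * (u * v) by intros; ring,
      tsum_mul_tsum_of_summable_norm h1 h2]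
    congr 1
    refine HasSum.tsum_eq (parityEquiv.hasSum_iff.mp ?_)
    have e1 := hg (c ^ 2) (p * z ^ 2) (pow_ne_zero _ hc) (mul_ne_zero hp0 (pow_ne_zero _ hz))
    have e2 := (hg (p * c ^ 2) (p ^ 2 * z ^ 2) (mul_ne_zero hp0 (pow_ne_zero _ hc))
      (mul_ne_zero hp20 (pow_ne_zero _ hz))).mul_left (-(c * z))
    rw [sub_eq_add_neg, ← neg_mul]
    refine HasSum.sum ?_ ?_
    · refine e1.congr_fun ?_
      rintro ⟨r, s⟩
      have ht : tri (r + s) + tri (r - s) = 2 * tri r + (2 * tri s + s) := by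
        have h1 := two_mul_tri (r + s)
        have h2 := two_mul_tri (r - s)
        have h3 := two_mul_tri r
        have h4 := two_mul_tri s
        linarith [show (r + s) * (r + s - 1) + (r - s) * (r - s - 1) =
          2 * (r * (r - 1)) + 2 * (s * (s - 1)) + 2 * s by ring]
      have hs : (-1 : ℂ) ^ (r + s) * (-1) ^ (r - s) = 1 := by
        rw [← zpow_add₀ (by norm_num), show r + s + (r - s) = r + r by ring]
        exact Even.neg_one_zpow ⟨r, rfl⟩
      have hp' : p ^ tri (r + s) * p ^ tri (r - s) =
          (p ^ 2) ^ tri r * ((p ^ 2) ^ tri s * p ^ s) := by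
        rw [← zpow_add₀ hp0, ht, zpow_add₀ hp0, zpow_add₀ hp0, zpow_mul, zpow_mul]; norm_cast
      have hx : (c * z) ^ (r + s) * (c / z) ^ (r - s) = (c ^ 2) ^ r * (z ^ 2) ^ s := by
        rw [mul_zpow, div_zpow, zpow_add₀ hc, zpow_add₀ hz, zpow_sub₀ hc, zpow_sub₀ hz]
        have := zpow_ne_zero r hc
        have := zpow_ne_zero s hc
        have := zpow_ne_zero r hz
        have := zpow_ne_zero s hz
        field_simp
        rw [← zpow_natCast, ← zpow_natCast, ← zpow_natCast, ← zpow_natCast, ← zpow_mul, ← zpow_mul,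
          ← zpow_mul, ← zpow_mul]
        push_cast
        rw [mul_comm r, mul_comm s]
      change (-1) ^ (r + s) * p ^ tri (r + s) * (c * z) ^ (r + s) *
        ((-1) ^ (r - s) * p ^ tri (r - s) * (c / z) ^ (r - s)) =
        (p ^ 2) ^ tri r * (c ^ 2) ^ r * ((p ^ 2) ^ tri s * (p * z ^ 2) ^ s)
      rw [mul_zpow p]
      linear_combination (p ^ tri (r + s) * (c * z) ^ (r + s) * (p ^ tri (r - s) *
        (c / z) ^ (r - s))) * hs + (c * z) ^ (r + s) * (c / z) ^ (r - s) * hp' +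
        (p ^ 2) ^ tri r * ((p ^ 2) ^ tri s * p ^ s) * hx
    · refine e2.congr_fun ?_
      rintro ⟨r, s⟩
      have ht : tri (r + s + 1) + tri (r - s) = (2 * tri r + r) + (2 * tri s + 2 * s) := by
        have h1 := two_mul_tri (r + s + 1)
        have h2 := two_mul_tri (r - s)
        have h3 := two_mul_tri r
        have h4 := two_mul_tri s
        linarith [show (r + s + 1) * (r + s + 1 - 1) + (r - s) * (r - s - 1) =
          2 * (r * (r - 1)) + 2 * r + 2 * (s * (s - 1)) + 4 * s by ring]
      have hs : (-1 : ℂ) ^ (r + s + 1) * (-1) ^ (r - s) = -1 := by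
        rw [← zpow_add₀ (by norm_num), show r + s + 1 + (r - s) = 2 * r + 1 by ring]
        exact Odd.neg_one_zpow ⟨r, rfl⟩
      have hp' : p ^ tri (r + s + 1) * p ^ tri (r - s) =
          (p ^ 2) ^ tri r * p ^ r * ((p ^ 2) ^ tri s * (p ^ 2) ^ s) := by
        rw [← zpow_add₀ hp0, ht, zpow_add₀ hp0, zpow_add₀ hp0, zpow_add₀ hp0, zpow_mul, zpow_mul,
          zpow_mul]
        norm_cast
      have hx : (c * z) ^ (r + s + 1) * (c / z) ^ (r - s) =
          c * z * ((c ^ 2) ^ r * (z ^ 2) ^ s) := by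
        rw [mul_zpow, div_zpow, zpow_add₀ hc, zpow_add₀ hz, zpow_add₀ hc, zpow_add₀ hz,
          zpow_sub₀ hc, zpow_sub₀ hz, zpow_one, zpow_one]
        have := zpow_ne_zero r hc
        have := zpow_ne_zero s hc
        have := zpow_ne_zero r hz
        have := zpow_ne_zero s hz
        field_simp
        rw [← zpow_natCast, ← zpow_natCast, ← zpow_natCast, ← zpow_natCast, ← zpow_mul, ← zpow_mul,
          ← zpow_mul, ← zpow_mul]
        push_cast
        rw [mul_comm r, mul_comm s]
      change (-1) ^ (r + s + 1) * p ^ tri (r + s + 1) * (c * z) ^ (r + s + 1) *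
        ((-1) ^ (r - s) * p ^ tri (r - s) * (c / z) ^ (r - s)) =
        -(c * z) * ((p ^ 2) ^ tri r * (p * c ^ 2) ^ r * ((p ^ 2) ^ tri s * (p ^ 2 * z ^ 2) ^ s))
      rw [mul_zpow p, mul_zpow (p ^ 2)]
      linear_combination (p ^ tri (r + s + 1) * (c * z) ^ (r + s + 1) * (p ^ tri (r - s) *
        (c / z) ^ (r - s))) * hs - (c * z) ^ (r + s + 1) * (c / z) ^ (r - s) * hp' -
        (p ^ 2) ^ tri r * p ^ r * ((p ^ 2) ^ tri s * (p ^ 2) ^ s) * hx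
  refine ⟨fun z => C * g (p * z ^ 2), fun z => C * (z * g (p ^ 2 * z ^ 2)), fun c z hc hz => ?_⟩
  -- Shifting the index by one shows that `g (c ^ 2)` is itself `c` times the `c`-part of `F₁`; this
  -- is what turns the difference into a minor.
  have hshift : g (c ^ 2) = c ^ 2 * g (p ^ 2 * c ^ 2) := by
    simp only [g]
    rw [← tsum_mul_left, ← (Equiv.addRight (1 : ℤ)).tsum_eq]
    refine tsum_congr fun j => ?_
    rw [Equiv.coe_addRight, tri_add_one, zpow_add₀ hp20, zpow_add_one₀ (pow_ne_zero _ hc), mul_zpow]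
    ring
  rw [hmul c z hc hz, hshift]
  ring

/-! ### A difference operator on even theta functions -/

/-- The minors of the pair of functions `F₀`, `F₁`. -/
def bracket (F₀ F₁ : ℂ → ℂ) (x y : ℂ) : ℂ := F₁ x * F₀ y - F₀ x * F₁ y

/-- The coefficient of the difference operator with parameters `a`, `b`, `c`, `d`. -/
def operatorWeight (p a b c d x : ℂ) : ℂ :=
  x⁻¹ * (theta p (a * x) * theta p (b * x) * theta p (c * x) * theta p (d * x)) / theta p (x ^ 2)

/-- Both arguments are inverses of the arguments in `hF`. The two signs cancel and the two
denominators multiply to `c ^ 2`. -/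
theorem theta_mul_theta_inv {p : ℂ} (hp : ‖p‖ < 1) {F₀ F₁ : ℂ → ℂ}
    (hF : ∀ c z : ℂ, c ≠ 0 → z ≠ 0 →
      theta p (c * z) * theta p (c / z) = c * bracket F₀ F₁ c z)
    {c z : ℂ} (hc : c ≠ 0) (hz : z ≠ 0) :
    theta p (c⁻¹ * z) * theta p (c⁻¹ / z) = c⁻¹ * bracket F₀ F₁ c z := by
  have h1 : c⁻¹ * z = (c / z)⁻¹ := by field_simp
  have h2 : c⁻¹ / z = (c * z)⁻¹ := by field_simp
  rw [h1, h2, theta_inv hp (div_ne_zero hc hz), theta_inv hp (mul_ne_zero hc hz)]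
  have := hF c z hc hz
  field_simp
  linear_combination this

/-- A balanced four-term identity, equivalent to the Weierstrass addition formula. -/
theorem operatorWeight_add_inv {p : ℂ} (hp : ‖p‖ < 1) {F₀ F₁ : ℂ → ℂ}
    (hF : ∀ c z : ℂ, c ≠ 0 → z ≠ 0 →
      theta p (c * z) * theta p (c / z) = c * bracket F₀ F₁ c z)
    {a b c d : ℂ} (habcd : a * b * c * d = 1) :
    ∃ K : ℂ, ∀ x : ℂ, x ≠ 0 → theta p (x ^ 2) ≠ 0 →
      operatorWeight p a b c d x + operatorWeight p a b c d x⁻¹ = K := by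
  have ha : a ≠ 0 := by rintro rfl; simp at habcd
  have hb : b ≠ 0 := by rintro rfl; simp at habcd
  have hc : c ≠ 0 := by rintro rfl; simp at habcd
  -- With `s ^ 2 = a b` the parameters become `s y`, `s / y`, `v / s`, `1 / (s v)`. The theta
  -- functions then pair off into minors among the four points `s x`, `x / s`, `y`, `v`.
  obtain ⟨s, hs⟩ := IsAlgClosed.exists_eq_mul_self (a * b)
  have hs0 : s ≠ 0 := by
    rintro rfl
    exact mul_ne_zero ha hb (by simpa using hs)
  have hb' : b = s / (a / s) := by field_simp; rw [pow_two, ← hs, mul_comm]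
  have hd' : d = 1 / (s * (c * s)) := by
    field_simp; linear_combination habcd - c * d * hs
  set y := a / s with hy
  set v := c * s with hv
  have ha' : a = s * y := by rw [hy]; field_simp
  have hc' : c = v / s := by rw [hv]; field_simp
  have hy0 : y ≠ 0 := div_ne_zero ha hs0
  have hv0 : v ≠ 0 := mul_ne_zero hc hs0
  refine ⟨theta p (s ^ 2) / s * bracket F₀ F₁ y v, fun x hx hθ => ?_⟩
  have hX : s * x ≠ 0 := mul_ne_zero hs0 hx
  have hU : x / s ≠ 0 := div_ne_zero hx hs0
  have e1 := hF (s * x) y hX hy0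
  have e2 := hF (x / s) v hU hv0
  have e3 := theta_mul_theta_inv hp hF hU hy0
  have e4 := theta_mul_theta_inv hp hF hX hv0
  have e5 := hF (s * x) (x / s) hX hU
  have f1 : s * x * y = a * x := by rw [ha']; ring
  have f2 : s * x / y = b * x := by rw [hb']; ring
  have f3 : x / s * v = c * x := by rw [hc']; ring
  have f4 : x / s / v = d * x := by rw [hd']; field_simp
  have f5 : (x / s)⁻¹ * y = a * x⁻¹ := by rw [ha']; field_simp
  have f6 : (x / s)⁻¹ / y = b * x⁻¹ := by rw [hb']; field_simp
  have f7 : (s * x)⁻¹ * v = c * x⁻¹ := by rw [hc']; field_simp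
  have f8 : (s * x)⁻¹ / v = d * x⁻¹ := by rw [hd']; field_simp
  have f9 : s * x * (x / s) = x ^ 2 := by field_simp
  have f10 : s * x / (x / s) = s ^ 2 := by field_simp
  rw [f1, f2] at e1
  rw [f3, f4] at e2
  rw [f5, f6] at e3
  rw [f7, f8] at e4
  rw [f9, f10] at e5
  have hinv : theta p (x⁻¹ ^ 2) = -theta p (x ^ 2) / x ^ 2 := by
    rw [inv_pow, theta_inv hp (pow_ne_zero _ hx)]
  -- The Plücker relation, which is the Weierstrass addition formula here. The factor `bracket F₀ F₁
  -- (s * x) (x / s)` is proportional to `θ(x ^ 2) θ(s ^ 2)` and cancels the denominator of the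
  -- weights.
  have hplu : bracket F₀ F₁ (s * x) y * bracket F₀ F₁ (x / s) v -
      bracket F₀ F₁ (x / s) y * bracket F₀ F₁ (s * x) v =
      bracket F₀ F₁ (s * x) (x / s) * bracket F₀ F₁ y v := by
    unfold bracket; ring
  unfold operatorWeight
  rw [hinv, mul_assoc (theta p (a * x) * _), mul_assoc (theta p (a * x⁻¹) * _), e1, e2, e3, e4]
  have e6 : theta p (s ^ 2) = s * x * bracket F₀ F₁ (s * x) (x / s) / theta p (x ^ 2) := by
    rw [← e5]; field_simp
  rw [e6]
  generalize bracket F₀ F₁ (s * x) y = b1 at *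
  generalize bracket F₀ F₁ (x / s) v = b2 at *
  generalize bracket F₀ F₁ (x / s) y = b3 at *
  generalize bracket F₀ F₁ (s * x) v = b4 at *
  generalize bracket F₀ F₁ (s * x) (x / s) = b5 at *
  field_simp
  linear_combination hplu

/-- The linear combination `c (F₁(c) F₀ - F₀(c) F₁)`. -/
def thetaForm (F₀ F₁ : ℂ → ℂ) (c : ℂ) : ℂ → ℂ := fun z => c * bracket F₀ F₁ c z

/-- The homogeneous polynomials of degree `m` in `F₀` and `F₁`. -/
def evenThetaSpace (F₀ F₁ : ℂ → ℂ) (m : ℕ) : Submodule ℂ (ℂ → ℂ) :=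
  Submodule.span ℂ {f | ∃ i j : ℕ, i + j = m ∧ f = F₀ ^ i * F₁ ^ j}

theorem thetaForm_mul_mem {F₀ F₁ : ℂ → ℂ} {m : ℕ} {f : ℂ → ℂ} (hf : f ∈ evenThetaSpace F₀ F₁ m)
    (c : ℂ) : thetaForm F₀ F₁ c * f ∈ evenThetaSpace F₀ F₁ (m + 1) := by
  unfold evenThetaSpace at hf
  induction hf using Submodule.span_induction with
  | mem f hf =>
    obtain ⟨i, j, hij, rfl⟩ := hf
    have : thetaForm F₀ F₁ c * (F₀ ^ i * F₁ ^ j) =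
        (c * F₁ c) • (F₀ ^ (i + 1) * F₁ ^ j) + (-(c * F₀ c)) • (F₀ ^ i * F₁ ^ (j + 1)) := by
      funext z
      simp [thetaForm, bracket]
      ring
    rw [this]
    exact add_mem (Submodule.smul_mem _ _ (Submodule.subset_span ⟨_, _, by omega, rfl⟩))
      (Submodule.smul_mem _ _ (Submodule.subset_span ⟨_, _, by omega, rfl⟩))
  | zero => simp
  | add f g _ _ hf hg => rw [mul_add]; exact add_mem hf hg
  | smul c f _ hf => rw [mul_smul_comm]; exact Submodule.smul_mem _ _ hf

/-- Products of `j` forms with parameters `A q ^ i` and `k` forms with parameters `B q ^ i`. -/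
def thetaProduct (F₀ F₁ : ℂ → ℂ) (q A B : ℂ) (j k : ℕ) : ℂ → ℂ :=
  (∏ i ∈ Finset.range j, thetaForm F₀ F₁ (A * q ^ i)) *
    ∏ i ∈ Finset.range k, thetaForm F₀ F₁ (B * q ^ i)

theorem thetaProduct_mem (F₀ F₁ : ℂ → ℂ) (q A B : ℂ) (j k : ℕ) :
    thetaProduct F₀ F₁ q A B j k ∈ evenThetaSpace F₀ F₁ (j + k) := by
  unfold thetaProduct
  induction j with
  | zero =>
    rw [Finset.prod_range_zero, one_mul, zero_add]
    induction k with
    | zero => exact Submodule.subset_span ⟨0, 0, rfl, by simp⟩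
    | succ k ih =>
      rw [Finset.prod_range_succ, mul_comm]
      exact thetaForm_mul_mem ih _
  | succ j ih =>
    rw [Finset.prod_range_succ, mul_comm (∏ i ∈ Finset.range j, _), mul_assoc,
      show j + 1 + k = j + k + 1 by ring]
    exact thetaForm_mul_mem ih _

/-- When their bracket does not vanish, the forms with parameters `A q ^ j` and `B q ^ k` span all
linear forms. Multiplying a product of type `(j, k)` by a linear form therefore gives products of
types `(j + 1, k)` and `(j, k + 1)`, and induction on the degree applies. -/
theorem evenThetaSpace_le_span {F₀ F₁ : ℂ → ℂ} {q A B : ℂ} (hq : q ≠ 0) (hA : A ≠ 0)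
    (hB : B ≠ 0) (m : ℕ)
    (hAB : ∀ i j : ℕ, i + j < m → bracket F₀ F₁ (A * q ^ i) (B * q ^ j) ≠ 0) :
    evenThetaSpace F₀ F₁ m ≤
      Submodule.span ℂ {f | ∃ j k : ℕ, j + k = m ∧ f = thetaProduct F₀ F₁ q A B j k} := by
  induction m with
  | zero =>
    refine Submodule.span_le.mpr ?_
    rintro f ⟨i, j, hij, rfl⟩
    obtain ⟨rfl, rfl⟩ : i = 0 ∧ j = 0 := by omega
    exact Submodule.subset_span ⟨0, 0, rfl, by simp [thetaProduct]⟩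
  | succ m ih =>
    specialize ih fun i j hij => hAB i j (by omega)
    have key : ∀ l : ℂ → ℂ, (∃ α β : ℂ, l = α • F₀ + β • F₁) → ∀ f ∈ evenThetaSpace F₀ F₁ m,
        l * f ∈ Submodule.span ℂ
          {f | ∃ j k : ℕ, j + k = m + 1 ∧ f = thetaProduct F₀ F₁ q A B j k} := by
      rintro l ⟨α, β, rfl⟩ f hf
      replace hf := ih hf
      induction hf using Submodule.span_induction with
      | mem f hf =>
        obtain ⟨j, k, hjk, rfl⟩ := hf
        have hne := hAB j k (by omega)
        set a := A * q ^ j with ha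
        set b := B * q ^ k with hb
        have ha0 : a ≠ 0 := mul_ne_zero hA (pow_ne_zero _ hq)
        have hb0 : b ≠ 0 := mul_ne_zero hB (pow_ne_zero _ hq)
        have hl : (α • F₀ + β • F₁) * thetaProduct F₀ F₁ q A B j k =
            ((α * F₀ b + β * F₁ b) / (a * bracket F₀ F₁ a b)) •
              thetaProduct F₀ F₁ q A B (j + 1) k +
            (-(α * F₀ a + β * F₁ a) / (b * bracket F₀ F₁ a b)) •
              thetaProduct F₀ F₁ q A B j (k + 1) := by
          funext z
          simp only [thetaProduct, Finset.prod_range_succ, Pi.add_apply, Pi.mul_apply,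
            Pi.smul_apply, smul_eq_mul, ← ha, ← hb]
          generalize (∏ i ∈ Finset.range j, thetaForm F₀ F₁ (A * q ^ i)) z = Q
          generalize (∏ i ∈ Finset.range k, thetaForm F₀ F₁ (B * q ^ i)) z = R
          simp only [thetaForm]
          field_simp
          unfold bracket
          ring
        rw [hl]
        exact add_mem (Submodule.smul_mem _ _ (Submodule.subset_span ⟨_, _, by omega, rfl⟩))
          (Submodule.smul_mem _ _ (Submodule.subset_span ⟨_, _, by omega, rfl⟩))
      | zero => simp
      | add f g _ _ hf hg => rw [mul_add]; exact add_mem hf hg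
      | smul c f _ hf => rw [mul_smul_comm]; exact Submodule.smul_mem _ _ hf
    refine Submodule.span_le.mpr ?_
    rintro f ⟨i, j, hij, rfl⟩
    rcases i with _ | i
    · obtain ⟨j, rfl⟩ : ∃ j', j = j' + 1 := ⟨j - 1, by omega⟩
      have := key F₁ ⟨0, 1, by simp⟩ (F₀ ^ 0 * F₁ ^ j)
        (Submodule.subset_span ⟨0, j, by omega, rfl⟩)
      rwa [show F₀ ^ 0 * F₁ ^ (j + 1) = F₁ * (F₀ ^ 0 * F₁ ^ j) by ring]
    · have := key F₀ ⟨1, 0, by simp⟩ (F₀ ^ i * F₁ ^ j)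
        (Submodule.subset_span ⟨i, j, by omega, rfl⟩)
      rwa [show F₀ ^ (i + 1) * F₁ ^ j = F₀ * (F₀ ^ i * F₁ ^ j) by ring]

/-- The quotient telescopes: raising the parameter by `s` while moving `a` to `s a` fixes `θ(u q ^ i
/ a)` and replaces `θ(u q ^ i a)` by `θ(u q ^ (i + 1) a)`, where `q = s ^ 2`. -/
theorem theta_mul_prod_thetaForm {p : ℂ} {F₀ F₁ : ℂ → ℂ}
    (hF : ∀ c z : ℂ, c ≠ 0 → z ≠ 0 →
      theta p (c * z) * theta p (c / z) = c * bracket F₀ F₁ c z)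
    {s u a : ℂ} (hs : s ≠ 0) (hu : u ≠ 0) (ha : a ≠ 0) (j : ℕ) :
    theta p (u * a) * (∏ i ∈ Finset.range j, thetaForm F₀ F₁ (u * s * (s ^ 2) ^ i)) (s * a) =
      theta p (u * (s ^ 2) ^ j * a) *
        (∏ i ∈ Finset.range j, thetaForm F₀ F₁ (u * (s ^ 2) ^ i)) a := by
  induction j with
  | zero => simp
  | succ j ih =>
    rw [Finset.prod_range_succ, Finset.prod_range_succ, Pi.mul_apply, Pi.mul_apply, ← mul_assoc,
      ih]
    have hsj : (s ^ 2) ^ j ≠ 0 := pow_ne_zero _ (pow_ne_zero _ hs)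
    have h1 := hF (u * s * (s ^ 2) ^ j) (s * a) (mul_ne_zero (mul_ne_zero hu hs) hsj)
      (mul_ne_zero hs ha)
    have h2 := hF (u * (s ^ 2) ^ j) a (mul_ne_zero hu hsj) ha
    simp only [thetaForm]
    rw [← h1, ← h2]
    have e1 : u * s * (s ^ 2) ^ j * (s * a) = u * (s ^ 2) ^ (j + 1) * a := by ring
    have e2 : u * s * (s ^ 2) ^ j / (s * a) = u * (s ^ 2) ^ j / a := by field_simp
    rw [e1, e2]
    ring

theorem theta_div_mul_prod_thetaForm {p : ℂ} {F₀ F₁ : ℂ → ℂ}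
    (hF : ∀ c z : ℂ, c ≠ 0 → z ≠ 0 →
      theta p (c * z) * theta p (c / z) = c * bracket F₀ F₁ c z)
    {s u a : ℂ} (hs : s ≠ 0) (hu : u ≠ 0) (ha : a ≠ 0) (j : ℕ) :
    theta p (u * a⁻¹) * (∏ i ∈ Finset.range j, thetaForm F₀ F₁ (u * s * (s ^ 2) ^ i)) (a / s) =
      theta p (u * (s ^ 2) ^ j * a⁻¹) *
        (∏ i ∈ Finset.range j, thetaForm F₀ F₁ (u * (s ^ 2) ^ i)) a := by
  induction j with
  | zero => simp
  | succ j ih =>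
    rw [Finset.prod_range_succ, Finset.prod_range_succ, Pi.mul_apply, Pi.mul_apply, ← mul_assoc,
      ih]
    have hsj : (s ^ 2) ^ j ≠ 0 := pow_ne_zero _ (pow_ne_zero _ hs)
    have h1 := hF (u * s * (s ^ 2) ^ j) (a / s) (mul_ne_zero (mul_ne_zero hu hs) hsj)
      (div_ne_zero ha hs)
    have h2 := hF (u * (s ^ 2) ^ j) a (mul_ne_zero hu hsj) ha
    simp only [thetaForm]
    rw [← h1, ← h2]
    have e1 : u * s * (s ^ 2) ^ j / (a / s) = u * (s ^ 2) ^ (j + 1) * a⁻¹ := by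
      field_simp; ring
    have e2 : u * s * (s ^ 2) ^ j * (a / s) = u * (s ^ 2) ^ j * a := by field_simp
    rw [e1, e2, div_eq_mul_inv _ a]
    ring

/-- The difference operator with parameters `a`, `b`, `c`, `d` and step `s`. -/
def thetaOperator (p s a b c d : ℂ) (f : ℂ → ℂ) (x : ℂ) : ℂ :=
  operatorWeight p a b c d x * f (s * x) + operatorWeight p a b c d x⁻¹ * f (x / s)

/-- By telescoping, the shifted products only change the parameters of the weight from `a`, `d` to
`a q ^ j`, `d q ^ k`. The hypothesis makes the new parameters balanced, so the two weights add up to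
a constant. -/
theorem thetaOperator_thetaProduct {p : ℂ} (hp : ‖p‖ < 1) {F₀ F₁ : ℂ → ℂ}
    (hF : ∀ c z : ℂ, c ≠ 0 → z ≠ 0 →
      theta p (c * z) * theta p (c / z) = c * bracket F₀ F₁ c z)
    {s a b c d : ℂ} (hs : s ≠ 0) {j k : ℕ}
    (habcd : (s ^ 2) ^ (j + k) * (a * b * c * d) = 1) :
    ∃ K : ℂ, ∀ x : ℂ, x ≠ 0 → theta p (x ^ 2) ≠ 0 →
      thetaOperator p s a b c d (thetaProduct F₀ F₁ (s ^ 2) (a * s) (d * s) j k) x =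
        K * thetaProduct F₀ F₁ (s ^ 2) a d j k x := by
  have ha : a ≠ 0 := by rintro rfl; simp at habcd
  have hd : d ≠ 0 := by rintro rfl; simp at habcd
  obtain ⟨K, hK⟩ := operatorWeight_add_inv hp hF
    (a := a * (s ^ 2) ^ j) (b := b) (c := c) (d := d * (s ^ 2) ^ k) (by rw [← habcd]; ring)
  refine ⟨K, fun x hx hθ => ?_⟩
  rw [← hK x hx hθ]
  have h1 := congrArg₂ (HMul.hMul (α := ℂ)) (theta_mul_prod_thetaForm hF hs ha hx j)
    (theta_mul_prod_thetaForm hF hs hd hx k)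
  have h2 := congrArg₂ (HMul.hMul (α := ℂ)) (theta_div_mul_prod_thetaForm hF hs ha hx j)
    (theta_div_mul_prod_thetaForm hF hs hd hx k)
  simp only [thetaOperator, operatorWeight, thetaProduct, Pi.mul_apply]
  generalize theta p (x ^ 2) = t1 at *
  generalize theta p (x⁻¹ ^ 2) = t2 at *
  linear_combination
    x⁻¹ * (theta p (b * x) * theta p (c * x)) / t1 * h1
    + x⁻¹⁻¹ * (theta p (b * x⁻¹) * theta p (c * x⁻¹)) / t2 * h2

/-- The operator is computed on a spanning set adapted to it, the products with parameters shifted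
from `a s` and `d s`. It maps each of them to a multiple of the product shifted from `a` and `d`,
which is of the same degree. -/
theorem thetaOperator_mem {p : ℂ} (hp : ‖p‖ < 1) {F₀ F₁ : ℂ → ℂ}
    (hF : ∀ c z : ℂ, c ≠ 0 → z ≠ 0 →
      theta p (c * z) * theta p (c / z) = c * bracket F₀ F₁ c z)
    {s a b c d : ℂ} (hs : s ≠ 0) {m : ℕ}
    (habcd : (s ^ 2) ^ m * (a * b * c * d) = 1)
    (had : ∀ i j : ℕ, i + j < m →
      bracket F₀ F₁ (a * s * (s ^ 2) ^ i) (d * s * (s ^ 2) ^ j) ≠ 0)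
    {f : ℂ → ℂ} (hf : f ∈ evenThetaSpace F₀ F₁ m) :
    ∃ g ∈ evenThetaSpace F₀ F₁ m, ∀ x : ℂ, x ≠ 0 → theta p (x ^ 2) ≠ 0 →
      thetaOperator p s a b c d f x = g x := by
  have ha : a ≠ 0 := by rintro rfl; simp at habcd
  have hd : d ≠ 0 := by rintro rfl; simp at habcd
  have hf' := evenThetaSpace_le_span (pow_ne_zero 2 hs) (mul_ne_zero ha hs) (mul_ne_zero hd hs) m
    had hf
  clear hf
  induction hf' using Submodule.span_induction with
  | mem f hf =>
    obtain ⟨j, k, rfl, rfl⟩ := hf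
    obtain ⟨K, hK⟩ := thetaOperator_thetaProduct hp hF hs habcd
    exact ⟨_, Submodule.smul_mem _ K (thetaProduct_mem F₀ F₁ (s ^ 2) a d j k), hK⟩
  | zero => exact ⟨0, zero_mem _, fun x _ _ => by simp [thetaOperator]⟩
  | add f₁ f₂ _ _ h₁ h₂ =>
    obtain ⟨g₁, hg₁, h₁⟩ := h₁
    obtain ⟨g₂, hg₂, h₂⟩ := h₂
    refine ⟨g₁ + g₂, add_mem hg₁ hg₂, fun x hx hθ => ?_⟩
    rw [Pi.add_apply, ← h₁ x hx hθ, ← h₂ x hx hθ]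
    simp only [thetaOperator, Pi.add_apply]
    ring
  | smul r f _ h =>
    obtain ⟨g, hg, h⟩ := h
    refine ⟨r • g, Submodule.smul_mem _ _ hg, fun x hx hθ => ?_⟩
    rw [Pi.smul_apply, ← h x hx hθ]
    simp only [thetaOperator, Pi.smul_apply, smul_eq_mul]
    ring

/-- The elliptic Vandermonde product is an eigenfunction of the multivariable difference
operator. -/
theorem sum_operatorWeight_mul_vandermonde {p : ℂ} (hp : ‖p‖ < 1) {F₀ F₁ : ℂ → ℂ}
    (hF : ∀ c z : ℂ, c ≠ 0 → z ≠ 0 →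
      theta p (c * z) * theta p (c / z) = c * bracket F₀ F₁ c z)
    {s a b c d : ℂ} (hs : s ≠ 0) {n m : ℕ} (hn : n = m + 1)
    (habcd : (s ^ 2) ^ m * (a * b * c * d) = 1)
    (had : ∀ i j : ℕ, i + j < m →
      bracket F₀ F₁ (a * s * (s ^ 2) ^ i) (d * s * (s ^ 2) ^ j) ≠ 0) :
    ∃ K : ℂ, ∀ x : Fin n → ℂ, (∀ k, x k ≠ 0) → (∀ k, theta p (x k ^ 2) ≠ 0) →
      ∑ J : Finset (Fin n),
        (∏ k, if k ∈ J then operatorWeight p a b c d (x k) else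
          operatorWeight p a b c d (x k)⁻¹) *
        (∏ k, ∏ l ∈ Finset.Ioi k, bracket F₀ F₁ (if k ∈ J then s * x k else x k / s)
          (if l ∈ J then s * x l else x l / s)) =
      K * ∏ k, ∏ l ∈ Finset.Ioi k, bracket F₀ F₁ (x k) (x l) := by
  subst hn
  let mono : Fin (m + 1) → ℂ → ℂ := fun j => F₀ ^ (j : ℕ) * F₁ ^ (j.rev : ℕ)
  have hmono : ∀ j, mono j ∈ evenThetaSpace F₀ F₁ m := fun j =>
    Submodule.subset_span ⟨j, j.rev, by rw [Fin.val_rev]; omega, rfl⟩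
  have hspan : ∀ g ∈ evenThetaSpace F₀ F₁ m, ∃ C : Fin (m + 1) → ℂ, ∑ i, C i • mono i = g := by
    intro g hg
    refine (Submodule.mem_span_range_iff_exists_fun ℂ).mp (Submodule.span_mono ?_ hg)
    rintro f ⟨i, j, hij, rfl⟩
    refine ⟨⟨i, by omega⟩, ?_⟩
    simp only [mono, Fin.val_rev]
    congr 2
    omega
  choose g hg hgx using fun j => thetaOperator_mem hp hF hs habcd had (hmono j)
  choose C hC using fun j => hspan (g j) (hg j)
  refine ⟨(Matrix.of C).det, fun x hx hθ => ?_⟩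
  -- The projective Vandermonde determinant: its columns are the monomials of degree `m` in `F₀`,
  -- `F₁`.
  have hvan : ∀ z : Fin (m + 1) → ℂ, ∏ k, ∏ l ∈ Finset.Ioi k, bracket F₀ F₁ (z k) (z l) =
      (Matrix.of fun k j => mono j (z k)).det := by
    intro z
    have := Matrix.det_projVandermonde (fun k => F₀ (z k)) (fun k => F₁ (z k))
    rw [show Matrix.of (fun k j => mono j (z k)) =
      Matrix.projVandermonde (fun k => F₀ (z k)) (fun k => F₁ (z k)) from rfl, this]
    refine Finset.prod_congr rfl fun k _ => Finset.prod_congr rfl fun l _ => ?_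
    unfold bracket; ring
  -- Applying the operator to each row multiplies the matrix by a constant one. Each resulting row
  -- is a sum of two rows, so multilinearity expands the determinant over the sets `J` of rows where
  -- the first is chosen.
  have hrow : (Matrix.of fun k j => mono j (x k)) * (Matrix.of C).transpose =
      Matrix.of ((fun k j => operatorWeight p a b c d (x k) * mono j (s * x k)) +
        fun k j => operatorWeight p a b c d (x k)⁻¹ * mono j (x k / s)) := by
    ext k j
    have := hgx j (x k) (hx k) (hθ k)
    rw [← hC j] at this
    simp only [Matrix.mul_apply, Matrix.of_apply, Matrix.transpose_apply, Pi.add_apply]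
    simp only [thetaOperator] at this
    rw [this]
    simp [mul_comm]
  rw [hvan, ← Matrix.det_transpose (Matrix.of C), mul_comm, ← Matrix.det_mul, hrow]
  have hadd := (Matrix.detRowAlternating (R := ℂ) (n := Fin (m + 1))).map_add_univ
    (fun k j => operatorWeight p a b c d (x k) * mono j (s * x k))
    (fun k j => operatorWeight p a b c d (x k)⁻¹ * mono j (x k / s))
  refine Eq.trans ?_ hadd.symm
  refine Finset.sum_congr rfl fun J _ => ?_
  rw [hvan (fun k => if k ∈ J then s * x k else x k / s), ← Matrix.det_mul_column]
  change Matrix.det _ = Matrix.det _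
  congr 1
  ext k j
  by_cases hk : k ∈ J <;> simp [hk, Finset.piecewise]

/-! ### Non-vanishing and compatibility of the one-particle weights -/

theorem mem_sites {N S T : ℕ} {t x : ℤ} :
    x ∈ sites N S T t ↔ 0 ≤ x ∧ t + S - T ≤ x ∧ x ≤ t + N - 1 ∧ x ≤ S + N - 1 := by
  unfold sites
  rw [Finset.mem_Icc]
  omega

theorem theta_inv_ne_zero {p x : ℂ} (hp : ‖p‖ < 1) (hx : x ≠ 0) (h : theta p x ≠ 0) :
    theta p x⁻¹ ≠ 0 := by
  rw [theta_inv hp hx]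
  exact div_ne_zero (neg_ne_zero.mpr h) hx

/-- The bare cancellation behind `w_mul_lozengeWeight`. Only the factors `A₁`, …, `A₆` that really
cancel are assumed non-zero; the others occur identically on both sides. -/
theorem cross_mul_identity {E₁ E₂ E₃ E₄ : ℂ} (hE : E₁ * E₂ = E₃ * E₄)
    {A₁ A₂ A₃ A₄ A₅ A₆ : ℂ} (h₁ : A₁ ≠ 0) (h₂ : A₂ ≠ 0) (h₃ : A₃ ≠ 0) (h₄ : A₄ ≠ 0)
    (h₅ : A₅ ≠ 0) (h₆ : A₆ ≠ 0) {r E B₁ B₂ B₃ B₄ B₅ B₆ B₇ B₈ B₉ : ℂ} :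
    -(E * (B₁ * A₃ * B₂ * B₃) / A₁) * (r * E₂ * A₁ / (A₃ * B₄ * A₅ * B₅)) *
        (E₁ * (B₆ * B₇ * A₅ * B₈) / B₉) =
      E₃ * (B₆ * B₇ * A₆ * B₈) / A₂ * (r * E₄ * A₂ / (B₄ * A₄ * B₅ * A₆)) *
        -(E * (B₁ * A₄ * B₂ * B₃) / B₉) := by
  have l : -(E * (B₁ * A₃ * B₂ * B₃) / A₁) * (r * E₂ * A₁ / (A₃ * B₄ * A₅ * B₅)) *
        (E₁ * (B₆ * B₇ * A₅ * B₈) / B₉) =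
      -(E * B₁ * B₂ * B₃ * r * B₆ * B₇ * B₈ * (B₄⁻¹ * B₅⁻¹ * B₉⁻¹)) * (E₁ * E₂) *
        ((A₁ / A₁) * (A₃ / A₃) * (A₅ / A₅)) := by
    simp only [div_eq_mul_inv, mul_inv]
    ring
  have r : E₃ * (B₆ * B₇ * A₆ * B₈) / A₂ * (r * E₄ * A₂ / (B₄ * A₄ * B₅ * A₆)) *
        -(E * (B₁ * A₄ * B₂ * B₃) / B₉) =
      -(E * B₁ * B₂ * B₃ * r * B₆ * B₇ * B₈ * (B₄⁻¹ * B₅⁻¹ * B₉⁻¹)) * (E₃ * E₄) *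
        ((A₂ / A₂) * (A₄ / A₄) * (A₆ / A₆)) := by
    simp only [div_eq_mul_inv, mul_inv]
    ring
  rw [l, r, hE]
  simp [h₁, h₂, h₃, h₄, h₅, h₆]

namespace Params

variable {P : Params}

namespace Generic

theorem rq_ne (hP : P.Generic) : P.rq ≠ 0 := by
  intro h
  exact hP.q_ne (by rw [← hP.rq_sq, h]; simp)

theorem rv_ne (hP : P.Generic) : P.rv ≠ 0 := by
  intro h
  exact mul_ne_zero hP.v₁_ne hP.v₂_ne (by rw [← hP.rv_sq, h]; simp)

theorem q_zpow (hP : P.Generic) (m : ℤ) : P.q ^ m = P.rq ^ (2 * m) := by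
  rw [← hP.rq_sq, zpow_mul]
  rfl

theorem theta_q_ne (hP : P.Generic) {m : ℤ} (h0 : m ≠ 0) (h1 : -((P.N : ℤ) + P.T) < m)
    (h2 : m < (P.N : ℤ) + P.T) : theta P.p (P.q ^ m) ≠ 0 := by
  rcases lt_or_gt_of_ne h0 with h | h
  · have := theta_inv_ne_zero hP.norm_p (zpow_ne_zero _ hP.q_ne)
      (hP.theta_q (-m) (by omega) (by omega))
    rwa [← zpow_neg, neg_neg] at this
  · exact hP.theta_q m h h2

theorem theta_site_ne (hP : P.Generic) {t x : ℤ} (hx : x ∈ sites P.N P.S P.T t) :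
    theta P.p (P.q ^ (2 * x + 1 - t - P.S) * (P.v₁ * P.v₂)) ≠ 0 := by
  obtain ⟨h1, h2, h3, h4⟩ := mem_sites.mp hx
  exact hP.theta_v₁v₂ _ (by omega) (by omega)

theorem w₀_ne (hP : P.Generic) {t x : ℤ} (ht : 0 ≤ t) (htT : t < P.T)
    (hx : x ∈ sites P.N P.S P.T t) (hx' : x ∈ sites P.N P.S P.T (t + 1)) : P.w₀ t x ≠ 0 := by
  have hS := hP.S_le_T
  obtain ⟨h1, h2, h3, h4⟩ := mem_sites.mp hx
  obtain ⟨h1', h2', h3', h4'⟩ := mem_sites.mp hx'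
  refine div_ne_zero (mul_ne_zero (zpow_ne_zero _ hP.q_ne) (mul_ne_zero (mul_ne_zero
    (mul_ne_zero ?_ ?_) ?_) ?_)) (hP.theta_site_ne hx)
  · exact hP.theta_q_ne (by omega) (by omega) (by omega)
  · exact hP.theta_v₁ _ (by omega) (by omega)
  · exact hP.theta_v₂ _ (by omega) (by omega)
  · exact hP.theta_v₁v₂ _ (by omega) (by omega)

theorem w₁_ne (hP : P.Generic) {t x : ℤ} (ht : 0 ≤ t) (htT : t < P.T)
    (hx : x ∈ sites P.N P.S P.T t) (hx' : x + 1 ∈ sites P.N P.S P.T (t + 1)) :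
    P.w₁ t x ≠ 0 := by
  have hS := hP.S_le_T
  obtain ⟨h1, h2, h3, h4⟩ := mem_sites.mp hx
  obtain ⟨h1', h2', h3', h4'⟩ := mem_sites.mp hx'
  refine neg_ne_zero.mpr (div_ne_zero (mul_ne_zero (zpow_ne_zero _ hP.q_ne) (mul_ne_zero
    (mul_ne_zero (mul_ne_zero ?_ ?_) ?_) ?_)) (hP.theta_site_ne hx))
  · exact hP.theta_q_ne (by omega) (by omega) (by omega)
  · exact hP.theta_v₁ _ (by omega) (by omega)
  · exact hP.theta_v₂ _ (by omega) (by omega)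
  · exact hP.theta_v₁v₂ _ (by omega) (by omega)

theorem lozengeWeight_eq (hP : P.Generic) (t x : ℤ) :
    P.lozengeWeight t (2 * (x + 1) - t) =
      P.rv * P.rq ^ (2 * x + 1 - t - P.S) *
        theta P.p (P.q ^ (2 * x + 1 - t - P.S) * (P.v₁ * P.v₂)) /
      (theta P.p (P.q ^ (x - 2 * t - P.S) * P.v₁) *
        theta P.p (P.q ^ (x + 1 - 2 * t - P.S) * P.v₁) *
        theta P.p (P.q ^ (x + t) * P.v₂) * theta P.p (P.q ^ (x + t + 1) * P.v₂)) := by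
  simp only [lozengeWeight, hP.q_zpow]
  rw [show 2 * (x + 1) - t - P.S - 1 = 2 * x + 1 - t - P.S by ring,
    show 2 * (2 * (x + 1) - t) - 2 * P.S - 2 = 2 * (2 * x + 1 - t - P.S) by ring,
    show 2 * (x + 1) - t - 3 * t - 2 * P.S - 2 = 2 * (x - 2 * t - P.S) by ring,
    show 2 * (x + 1) - t - 3 * t - 2 * P.S = 2 * (x + 1 - 2 * t - P.S) by ring,
    show 2 * (x + 1) - t + 3 * t - 2 = 2 * (x + t) by ring,
    show 2 * (x + 1) - t + 3 * t = 2 * (x + t + 1) by ring]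

/-- The lines `0` and `T` must be excluded: there the exponents of `v₁` can reach `N - S` and `-2T`,
which genericity does not cover. Path families have no holes on these lines. -/
theorem lozengeWeight_ne (hP : P.Generic) {t x : ℤ} (ht : 0 < t) (htT : t < P.T)
    (hx : x ∈ sites P.N P.S P.T t) : P.lozengeWeight t (2 * (x + 1) - t) ≠ 0 := by
  have hS := hP.S_le_T
  obtain ⟨h1, h2, h3, h4⟩ := mem_sites.mp hx
  rw [hP.lozengeWeight_eq]
  refine div_ne_zero (mul_ne_zero (mul_ne_zero hP.rv_ne (zpow_ne_zero _ hP.rq_ne))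
    (hP.theta_site_ne hx)) (mul_ne_zero (mul_ne_zero (mul_ne_zero ?_ ?_) ?_) ?_)
  · exact hP.theta_v₁ _ (by omega) (by omega)
  · exact hP.theta_v₁ _ (by omega) (by omega)
  · exact hP.theta_v₂ _ (by omega) (by omega)
  · exact hP.theta_v₂ _ (by omega) (by omega)

/-- The one-particle weights at times `t - 1` and `t` are compatible with the weights of the
lozenges. -/
theorem w_mul_lozengeWeight (hP : P.Generic) {t x : ℤ} (ht : 0 < t) (htT : t < P.T)
    (hx : x ∈ sites P.N P.S P.T t) (hx' : x + 1 ∈ sites P.N P.S P.T t) :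
    P.w₁ t x * P.lozengeWeight t (2 * (x + 1) - t) * P.w₀ (t - 1) x =
      P.w₀ t (x + 1) * P.lozengeWeight t (2 * (x + 1 + 1) - t) * P.w₁ (t - 1) x := by
  have hS := hP.S_le_T
  have a1 := hP.theta_site_ne hx
  have a2 := hP.theta_site_ne hx'
  obtain ⟨h1, h2, h3, h4⟩ := mem_sites.mp hx
  obtain ⟨h1', h2', h3', h4'⟩ := mem_sites.mp hx'
  have a3 : theta P.p (P.q ^ (x - 2 * t - P.S) * P.v₁) ≠ 0 :=
    hP.theta_v₁ _ (by omega) (by omega)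
  have a4 : theta P.p (P.q ^ (x + 1 + 1 - 2 * t - P.S) * P.v₁) ≠ 0 :=
    hP.theta_v₁ _ (by omega) (by omega)
  have a5 : theta P.p (P.q ^ (x + t) * P.v₂) ≠ 0 :=
    hP.theta_v₂ _ (by omega) (by omega)
  have a6 : theta P.p (P.q ^ (x + 1 + t + 1) * P.v₂) ≠ 0 :=
    hP.theta_v₂ _ (by omega) (by omega)
  rw [hP.lozengeWeight_eq, hP.lozengeWeight_eq]
  unfold w₀ w₁
  rw [show x + P.T - (t - 1) - P.S = x + 1 + P.T - t - P.S by ring,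
    show x - P.T - (t - 1) - P.S = x + 1 - P.T - t - P.S by ring,
    show x + (t - 1) + 1 = x + t by ring,
    show x + P.N - (t - 1) = x + 1 + P.N - t by ring,
    show x - 2 * (t - 1) - P.S = x + 1 + 1 - 2 * t - P.S by ring,
    show x + 1 + t = x + t + 1 by ring] at *
  have hq := hP.rq_ne
  have e : P.q ^ (-x - P.N + 1) * P.rq ^ (2 * x + 1 - t - P.S) =
      P.q ^ (-(x + 1) - P.N + 1) * P.rq ^ (2 * (x + 1) + 1 - t - P.S) := by
    rw [hP.q_zpow, hP.q_zpow, ← zpow_add₀ hq, ← zpow_add₀ hq]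
    congr 1
    ring
  exact cross_mul_identity e a1 a2 a3 a4 a5 a6

end Generic

end Params

/-! ### The multiplicative coordinate and the summation formula -/

namespace Params

/-- The scaling factor of the multiplicative coordinate on the line `t`. -/
def coordScale (P : Params) (t : ℤ) : ℂ := P.rq ^ (1 - t - P.S) * P.rv

/-- The multiplicative coordinate of the site `x` on the line `t`. -/
def coord (P : Params) (t x : ℤ) : ℂ := P.q ^ x * P.coordScale t

variable {P : Params}

namespace Generic

theorem coordScale_ne (hP : P.Generic) (t : ℤ) : P.coordScale t ≠ 0 :=
  mul_ne_zero (zpow_ne_zero _ hP.rq_ne) hP.rv_ne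

theorem coord_ne (hP : P.Generic) (t x : ℤ) : P.coord t x ≠ 0 :=
  mul_ne_zero (zpow_ne_zero _ hP.q_ne) (hP.coordScale_ne t)

theorem coordScale_sq (hP : P.Generic) (t : ℤ) :
    P.coordScale t ^ 2 = P.q ^ (1 - t - P.S) * (P.v₁ * P.v₂) := by
  rw [coordScale, mul_pow, hP.rv_sq, hP.q_zpow, mul_comm 2, zpow_mul]
  rfl

theorem coord_mul_coord (hP : P.Generic) (t x y : ℤ) :
    P.coord t x * P.coord t y = P.q ^ (x + y + 1 - t - P.S) * (P.v₁ * P.v₂) := by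
  have h := hP.coordScale_sq t
  have e : P.q ^ (x + y + 1 - t - P.S) = P.q ^ x * P.q ^ y * P.q ^ (1 - t - P.S) := by
    rw [← zpow_add₀ hP.q_ne, ← zpow_add₀ hP.q_ne]
    congr 1
    ring
  rw [e, coord, coord]
  linear_combination P.q ^ x * P.q ^ y * h

theorem coord_sq (hP : P.Generic) (t x : ℤ) :
    P.coord t x ^ 2 = P.q ^ (2 * x + 1 - t - P.S) * (P.v₁ * P.v₂) := by
  rw [pow_two, hP.coord_mul_coord, two_mul]

theorem coordScale_succ (hP : P.Generic) (t : ℤ) :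
    P.coordScale (t + 1) = P.coordScale t / P.rq := by
  rw [coordScale, coordScale, show 1 - (t + 1) - (P.S : ℤ) = 1 - t - P.S - 1 by ring,
    zpow_sub_one₀ hP.rq_ne]
  field_simp

theorem coord_succ (hP : P.Generic) (t x : ℤ) : P.coord (t + 1) x = P.coord t x / P.rq := by
  rw [coord, hP.coordScale_succ, coord, mul_div_assoc]

theorem coord_succ_succ (hP : P.Generic) (t x : ℤ) :
    P.coord (t + 1) (x + 1) = P.rq * P.coord t x := by
  have := hP.rq_ne
  rw [coord, hP.coordScale_succ, coord, zpow_add_one₀ hP.q_ne, ← hP.rq_sq]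
  field_simp

/-- In the coordinate of the line, the quotient and the product of two sites give exactly the two
theta arguments of `phi`. -/
theorem phi_eq (hP : P.Generic) {F₀ F₁ : ℂ → ℂ}
    (hF : ∀ c z : ℂ, c ≠ 0 → z ≠ 0 →
      theta P.p (c * z) * theta P.p (c / z) = c * bracket F₀ F₁ c z) (t x y : ℤ) :
    P.phi t x y = P.coordScale t * bracket F₀ F₁ (P.coord t x) (P.coord t y) := by
  have h := hF _ _ (hP.coord_ne t x) (hP.coord_ne t y)
  have hu := hP.coordScale_ne t
  have hd : P.coord t x / P.coord t y = P.q ^ (x - y) := by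
    rw [coord, coord, mul_div_mul_right _ _ hu, zpow_sub₀ hP.q_ne]
  rw [hd, hP.coord_mul_coord] at h
  rw [phi, mul_assoc, mul_comm (theta P.p _), h, coord, zpow_neg]
  have := zpow_ne_zero x hP.q_ne
  field_simp

theorem w₁_eq (hP : P.Generic) (t x : ℤ) :
    P.w₁ t x = -P.coordScale t * operatorWeight P.p
      (P.q ^ (1 - P.N - P.S : ℤ) / P.coordScale t)
      (P.q ^ (-2 * t - P.S) * P.v₁ / P.coordScale t)
      (P.q ^ (P.T + 1 : ℤ) * P.v₂ / P.coordScale t)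
      (P.q ^ (1 - P.T : ℤ) * (P.v₁ * P.v₂) / P.coordScale t) (P.coord t x) := by
  have hu := hP.coordScale_ne t
  have hq := hP.q_ne
  have hm : ∀ (m : ℤ) (r : ℂ), P.q ^ m * r / P.coordScale t * P.coord t x =
      P.q ^ (m + x) * r := by
    intro m r
    rw [coord, zpow_add₀ hq]
    field_simp
  have hm' : P.q ^ (1 - P.N - P.S : ℤ) / P.coordScale t * P.coord t x =
      P.q ^ (x + 1 - P.N - P.S : ℤ) := by
    have := hm (1 - P.N - P.S) 1
    rw [mul_one, mul_one] at this
    rw [this]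
    congr 1
    ring
  rw [operatorWeight, hP.coord_sq, hm, hm, hm, hm', w₁,
    show -2 * t - P.S + x = x - 2 * t - P.S by ring, show (P.T : ℤ) + 1 + x = x + P.T + 1 by ring,
    show 1 - (P.T : ℤ) + x = x - P.T + 1 by ring, coord, zpow_neg]
  have := zpow_ne_zero x hq
  field_simp

/-- Stay and jump weights are the same function at inverse points. Inversion exchanges the roles of
the parameters in pairs: first with last, second with third. The leftover monomial is the prefactor
of `w₀`. -/
theorem w₀_eq (hP : P.Generic) (t x : ℤ) :
    P.w₀ t x = -P.coordScale t * operatorWeight P.p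
      (P.q ^ (1 - P.N - P.S : ℤ) / P.coordScale t)
      (P.q ^ (-2 * t - P.S) * P.v₁ / P.coordScale t)
      (P.q ^ (P.T + 1 : ℤ) * P.v₂ / P.coordScale t)
      (P.q ^ (1 - P.T : ℤ) * (P.v₁ * P.v₂) / P.coordScale t) (P.coord t x)⁻¹ := by
  have hu := hP.coordScale_ne t
  have hq := hP.q_ne
  have hv₁ := hP.v₁_ne
  have hv₂ := hP.v₂_ne
  have hu2 := hP.coordScale_sq t
  have hm : ∀ (m : ℤ) (r : ℂ), P.q ^ m * r / P.coordScale t * (P.coord t x)⁻¹ =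
      P.q ^ (m - x - (1 - t - P.S)) * r / (P.v₁ * P.v₂) := by
    intro m r
    have : P.q ^ m * r / P.coordScale t * (P.coord t x)⁻¹ =
        P.q ^ m * r / (P.q ^ x * P.coordScale t ^ 2) := by
      rw [coord]
      field_simp
    rw [this, hu2, zpow_sub₀ hq (m - x), zpow_sub₀ hq m]
    simp only [div_eq_mul_inv, mul_inv]
    ring
  have e1 : P.q ^ (1 - P.N - P.S : ℤ) / P.coordScale t * (P.coord t x)⁻¹ =
      (P.q ^ (x + P.N - t) * (P.v₁ * P.v₂))⁻¹ := by
    have := hm (1 - P.N - P.S) 1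
    rw [mul_one, mul_one] at this
    rw [this, mul_inv, ← zpow_neg, div_eq_mul_inv]
    congr 2
    ring
  have e2 : P.q ^ (-2 * t - P.S) * P.v₁ / P.coordScale t * (P.coord t x)⁻¹ =
      (P.q ^ (x + t + 1) * P.v₂)⁻¹ := by
    rw [hm, mul_inv, ← zpow_neg, show -2 * t - P.S - x - (1 - t - P.S) = -(x + t + 1) by ring]
    field_simp
  have e3 : P.q ^ (P.T + 1 : ℤ) * P.v₂ / P.coordScale t * (P.coord t x)⁻¹ =
      (P.q ^ (x - P.T - t - P.S) * P.v₁)⁻¹ := by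
    rw [hm, mul_inv, ← zpow_neg,
      show (P.T : ℤ) + 1 - x - (1 - t - P.S) = -(x - P.T - t - P.S) by ring]
    field_simp
  have e4 : P.q ^ (1 - P.T : ℤ) * (P.v₁ * P.v₂) / P.coordScale t * (P.coord t x)⁻¹ =
      (P.q ^ (x + P.T - t - P.S))⁻¹ := by
    rw [hm, ← zpow_neg,
      show 1 - (P.T : ℤ) - x - (1 - t - P.S) = -(x + P.T - t - P.S) by ring]
    field_simp
  have n1 := mul_ne_zero (zpow_ne_zero (x + P.N - t) hq) (mul_ne_zero hv₁ hv₂)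
  have n2 := mul_ne_zero (zpow_ne_zero (x + t + 1) hq) hv₂
  have n3 := mul_ne_zero (zpow_ne_zero (x - P.T - t - P.S) hq) hv₁
  have n4 := zpow_ne_zero (x + P.T - t - P.S) hq
  have hz := hP.coord_ne t x
  have hp := hP.norm_p
  rw [operatorWeight, inv_pow, inv_inv, theta_inv hp (pow_ne_zero 2 hz), e1, e2, e3, e4,
    theta_inv hp n1, theta_inv hp n2, theta_inv hp n3, theta_inv hp n4, w₀, hP.coord_sq]
  have hprod : P.q ^ (-x - P.N + 1) * ((P.q ^ (x + P.N - t) * (P.v₁ * P.v₂)) *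
      (P.q ^ (x + t + 1) * P.v₂) * (P.q ^ (x - P.T - t - P.S) * P.v₁) *
      P.q ^ (x + P.T - t - P.S)) = P.coordScale t * P.coord t x *
      (P.q ^ (2 * x + 1 - t - P.S) * (P.v₁ * P.v₂)) := by
    have c1 : P.coordScale t * P.coord t x = P.q ^ x * P.coordScale t ^ 2 := by
      rw [coord]; ring
    have c2 : P.q ^ (-x - P.N + 1) * (P.q ^ (x + P.N - t) * P.q ^ (x + t + 1) *
        P.q ^ (x - P.T - t - P.S) * P.q ^ (x + P.T - t - P.S)) =
        P.q ^ x * P.q ^ (1 - t - P.S) * P.q ^ (2 * x + 1 - t - P.S) := by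
      simp only [← zpow_add₀ hq]
      congr 1
      ring
    rw [c1, hu2]
    linear_combination (P.v₁ * P.v₂) ^ 2 * c2
  generalize P.q ^ (-x - P.N + 1) = Q at *
  generalize P.q ^ (x + P.N - t) * (P.v₁ * P.v₂) = Q1 at *
  generalize P.q ^ (x + t + 1) * P.v₂ = Q2 at *
  generalize P.q ^ (x - P.T - t - P.S) * P.v₁ = Q3 at *
  generalize P.q ^ (x + P.T - t - P.S) = Q4 at *
  generalize P.q ^ (2 * x + 1 - t - P.S) * (P.v₁ * P.v₂) = Q5 at *
  have hQ : Q = P.coordScale t * P.coord t x * Q5 / (Q1 * Q2 * Q3 * Q4) := by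
    rw [← hprod]; field_simp
  rw [hQ]
  simp only [div_eq_mul_inv, mul_inv, inv_inv, inv_neg]
  ring

/-- The transition weights sum up to a constant. -/
theorem sum_vandermonde (hP : P.Generic) {t : ℤ} (ht : 0 ≤ t) (htT : t < P.T) :
    ∃ K : ℂ, ∀ X : Fin P.N → ℤ, (∀ k, X k ∈ sites P.N P.S P.T t) →
      ∑ J : Finset (Fin P.N), (∏ k, if k ∈ J then P.w₁ t (X k) else P.w₀ t (X k)) *
        (∏ k, ∏ l ∈ Finset.Ioi k, P.phi (t + 1) (if k ∈ J then X k + 1 else X k)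
          (if l ∈ J then X l + 1 else X l)) =
      K * ∏ k, ∏ l ∈ Finset.Ioi k, P.phi t (X k) (X l) := by
  rcases Nat.eq_zero_or_pos P.N with hN | hN
  · have : IsEmpty (Fin P.N) := by rw [hN]; infer_instance
    exact ⟨1, fun X _ => by simp⟩
  obtain ⟨m, hm⟩ : ∃ m, P.N = m + 1 := ⟨P.N - 1, by omega⟩
  have hp := hP.norm_p
  have hq := hP.q_ne
  have hS := hP.S_le_T
  have hv₁ := hP.v₁_ne
  have hv₂ := hP.v₂_ne
  have hs := hP.rq_ne
  have hu := hP.coordScale_ne t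
  have hu2 := hP.coordScale_sq t
  obtain ⟨F₀, F₁, hF⟩ := exists_theta_mul_theta hp
  replace hF : ∀ c z : ℂ, c ≠ 0 → z ≠ 0 →
      theta P.p (c * z) * theta P.p (c / z) = c * bracket F₀ F₁ c z := hF
  -- The balancing condition for degree `N - 1`.
  have hbal : (P.rq ^ 2) ^ m * (P.q ^ (1 - P.N - P.S : ℤ) / P.coordScale t *
      (P.q ^ (-2 * t - P.S) * P.v₁ / P.coordScale t) *
      (P.q ^ (P.T + 1 : ℤ) * P.v₂ / P.coordScale t) *
      (P.q ^ (1 - P.T : ℤ) * (P.v₁ * P.v₂) / P.coordScale t)) = 1 := by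
    have c1 : P.q ^ (m : ℤ) * (P.q ^ (1 - P.N - P.S : ℤ) * P.q ^ (-2 * t - P.S) *
        P.q ^ (P.T + 1 : ℤ) * P.q ^ (1 - P.T : ℤ)) =
        P.q ^ (1 - t - P.S) * P.q ^ (1 - t - P.S) := by
      simp only [← zpow_add₀ hq]
      congr 1
      omega
    rw [hP.rq_sq, ← zpow_natCast P.q m]
    field_simp
    rw [show P.coordScale t ^ 4 = (P.coordScale t ^ 2) ^ 2 by ring, hu2]
    linear_combination P.v₁ ^ 2 * P.v₂ ^ 2 * c1
  -- The first and last parameters are chosen because `v₁` and `v₂` separately drop out. The bracket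
  -- reduces to `θ(q ^ e)` with `e = 2 - N - T + t + i + j`, negative because `t < T` and `i + j < N
  -- - 1`, and a theta function of `v₁ v₂` in the generic range.
  have had : ∀ i j : ℕ, i + j < m →
      bracket F₀ F₁ (P.q ^ (1 - P.N - P.S : ℤ) / P.coordScale t * P.rq * (P.rq ^ 2) ^ i)
        (P.q ^ (1 - P.T : ℤ) * (P.v₁ * P.v₂) / P.coordScale t * P.rq * (P.rq ^ 2) ^ j) ≠ 0 := by
    intro i j hij
    have n1 : P.q ^ (1 - P.N - P.S : ℤ) / P.coordScale t * P.rq * (P.rq ^ 2) ^ i ≠ 0 := by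
      have := zpow_ne_zero (1 - P.N - P.S : ℤ) hq
      positivity
    have n2 : P.q ^ (1 - P.T : ℤ) * (P.v₁ * P.v₂) / P.coordScale t * P.rq * (P.rq ^ 2) ^ j ≠ 0 := by
      have := zpow_ne_zero (1 - P.T : ℤ) hq
      positivity
    have h := hF _ _ n1 n2
    intro h0
    rw [h0, mul_zero] at h
    rw [hP.rq_sq] at h
    have e1 : P.q ^ (1 - P.N - P.S : ℤ) / P.coordScale t * P.rq * P.q ^ i *
        (P.q ^ (1 - P.T : ℤ) * (P.v₁ * P.v₂) / P.coordScale t * P.rq * P.q ^ j) =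
        P.q ^ (2 - P.N - P.T + t + i + j : ℤ) := by
      have c1 : P.q ^ (1 - P.N - P.S : ℤ) * P.q ^ (1 - P.T : ℤ) * P.q * P.q ^ (i : ℤ) *
          P.q ^ (j : ℤ) = P.q ^ (2 - P.N - P.T + t + i + j : ℤ) * P.q ^ (1 - t - P.S) := by
        simp only [← zpow_add₀ hq, ← zpow_add_one₀ hq]
        congr 1
        ring
      rw [← zpow_natCast P.q i, ← zpow_natCast P.q j]
      have hu3 : P.coordScale t * P.coordScale t = P.q ^ (1 - t - P.S) * (P.v₁ * P.v₂) := by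
        rw [← hu2]; ring
      have n3 := zpow_ne_zero (1 - t - P.S) hq
      calc _ = (P.q ^ (1 - P.N - P.S : ℤ) * P.q ^ (1 - P.T : ℤ) * P.rq ^ 2 * P.q ^ (i : ℤ) *
          P.q ^ (j : ℤ)) * (P.v₁ * P.v₂) / (P.coordScale t * P.coordScale t) := by
            simp only [div_eq_mul_inv, mul_inv]; ring
        _ = _ := by
            rw [hP.rq_sq, c1, hu3]
            field_simp
    have e2 : P.q ^ (1 - P.N - P.S : ℤ) / P.coordScale t * P.rq * P.q ^ i /
        (P.q ^ (1 - P.T : ℤ) * (P.v₁ * P.v₂) / P.coordScale t * P.rq * P.q ^ j) =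
        (P.q ^ (P.N + P.S - P.T + j - i : ℤ) * (P.v₁ * P.v₂))⁻¹ := by
      have c1 : P.q ^ (1 - P.N - P.S : ℤ) * P.q ^ (i : ℤ) * P.q ^ (P.N + P.S - P.T + j - i : ℤ) =
          P.q ^ (1 - P.T : ℤ) * P.q ^ (j : ℤ) := by
        simp only [← zpow_add₀ hq]
        congr 1
        ring
      rw [← zpow_natCast P.q i, ← zpow_natCast P.q j]
      have n3 := zpow_ne_zero (1 - P.T : ℤ) hq
      have n4 := zpow_ne_zero (j : ℤ) hq
      have n5 := zpow_ne_zero (P.N + P.S - P.T + j - i : ℤ) hq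
      rw [div_eq_iff (by positivity), eq_comm, inv_mul_eq_iff_eq_mul₀ (by positivity)]
      simp only [div_eq_mul_inv]
      linear_combination -(P.v₁ * P.v₂ * (P.coordScale t)⁻¹ * P.rq) * c1
    rw [e1, e2] at h
    refine mul_ne_zero (hP.theta_q_ne ?_ ?_ ?_) (theta_inv_ne_zero hp ?_
      (hP.theta_v₁v₂ _ ?_ ?_)) h
    · omega
    · omega
    · omega
    · exact mul_ne_zero (zpow_ne_zero _ hq) (mul_ne_zero hv₁ hv₂)
    · omega
    · omega
  obtain ⟨K, hK⟩ := sum_operatorWeight_mul_vandermonde hp hF hs hm hbal had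
  have hC : ∀ r : ℂ, r ≠ 0 → ∏ k : Fin P.N, ∏ _l ∈ Finset.Ioi k, r ≠ 0 := fun r hr =>
    Finset.prod_ne_zero_iff.mpr fun k _ => Finset.prod_ne_zero_iff.mpr fun _ _ => hr
  -- Each particle contributes `-coordScale t`, and each pair contributes the scale of `phi` on its
  -- line.
  refine ⟨(∏ _k : Fin P.N, -P.coordScale t) *
    (∏ k : Fin P.N, ∏ _l ∈ Finset.Ioi k, P.coordScale (t + 1)) * K /
    ∏ k : Fin P.N, ∏ _l ∈ Finset.Ioi k, P.coordScale t, fun X hX => ?_⟩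
  specialize hK (fun k => P.coord t (X k)) (fun k => hP.coord_ne t _) fun k => by
    rw [hP.coord_sq]; exact hP.theta_site_ne (hX k)
  have hphi : ∏ k, ∏ l ∈ Finset.Ioi k, P.phi t (X k) (X l) =
      (∏ k : Fin P.N, ∏ _l ∈ Finset.Ioi k, P.coordScale t) *
      ∏ k, ∏ l ∈ Finset.Ioi k, bracket F₀ F₁ (P.coord t (X k)) (P.coord t (X l)) := by
    simp only [← Finset.prod_mul_distrib, hP.phi_eq hF]
  have hC' := hC _ hu
  rw [hphi]
  have hR : ∀ a b c d e : ℂ, d ≠ 0 → a * b * c / d * (d * e) = a * b * (c * e) := by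
    intros; field_simp
  rw [hR _ _ _ _ _ hC', ← hK, Finset.mul_sum]
  refine Finset.sum_congr rfl fun J _ => ?_
  have hmul : ∀ a b c d : ℂ, a * b * (c * d) = (a * c) * (b * d) := by intros; ring
  rw [hmul]
  congr 1
  · rw [← Finset.prod_mul_distrib]
    refine Finset.prod_congr rfl fun k _ => ?_
    split_ifs
    · exact hP.w₁_eq t _
    · exact hP.w₀_eq t _
  · simp only [← Finset.prod_mul_distrib, hP.phi_eq hF]
    refine Finset.prod_congr rfl fun k _ => Finset.prod_congr rfl fun l _ => ?_
    have hc : ∀ k : Fin P.N, P.coord (t + 1) (if k ∈ J then X k + 1 else X k) =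
        if k ∈ J then P.rq * P.coord t (X k) else P.coord t (X k) / P.rq := by
      intro k
      split_ifs
      · exact hP.coord_succ_succ t _
      · exact hP.coord_succ t _
    rw [hc, hc]

end Generic

end Params

namespace Params

/-! ### The Markov property -/

/-- The configuration in which the particles of `J` have jumped up by one. -/
def jump {N : ℕ} (J : Finset (Fin N)) (X : Fin N → ℤ) : Fin N → ℤ :=
  fun k => if k ∈ J then X k + 1 else X k

variable (P : Params)

/-- The weight of the holes of a configuration on the line `t`. -/
def lineWeight (t : ℤ) (X : Fin P.N → ℤ) : ℂ :=
  ∏ x ∈ P.holes t X, P.lozengeWeight t (2 * (x + 1) - t)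

/-- The weight of a transition from `X` to a configuration `Y` on the line `t`. -/
def stepWeight (t : ℤ) (X Y : Fin P.N → ℤ) : ℂ :=
  if (∀ k, Y k = X k ∨ Y k = X k + 1) ∧ StrictMono Y then P.lineWeight t Y else 0

/-- The total weight of all continuations of a path family after it has reached a configuration
on the line `t`. -/
def futureWeight : Fin (P.T + 1) → (Fin P.N → ℤ) → ℂ :=
  Fin.reverseInduction (motive := fun _ => (Fin P.N → ℤ) → ℂ)
    (fun X => if ∀ k : Fin P.N, X k = (P.S : ℤ) + (k : ℤ) then 1 else 0)
    (fun t Z X => ∑ J : Finset (Fin P.N),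
      P.stepWeight (t.succ : ℕ) X (jump J X) * Z (jump J X))

theorem futureWeight_last (X : Fin P.N → ℤ) : P.futureWeight (Fin.last P.T) X =
    if ∀ k : Fin P.N, X k = (P.S : ℤ) + (k : ℤ) then 1 else 0 := by
  simp [futureWeight]

theorem futureWeight_castSucc (t : Fin P.T) (X : Fin P.N → ℤ) :
    P.futureWeight t.castSucc X = ∑ J : Finset (Fin P.N),
      P.stepWeight (t.succ : ℕ) X (jump J X) * P.futureWeight t.succ (jump J X) := by
  simp [futureWeight]

/-- The total weight of an event. -/
def mass (A : Set (Trajectory P.N P.T)) : ℂ :=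
  ∑ ω ∈ Omega P.N P.S P.T with ω ∈ A, P.tilingWeight ω

/-- The part of a trajectory up to time `t` is the beginning of a path family. -/
def IsBeginning (t : Fin (P.T + 1)) (H : Trajectory P.N P.T) : Prop :=
  (∀ k : Fin P.N, H 0 k = (k : ℤ)) ∧
    (∀ s : Fin P.T, s.succ ≤ t → ∀ k : Fin P.N,
      H s.succ k = H s.castSucc k ∨ H s.succ k = H s.castSucc k + 1) ∧
    ∀ s ≤ t, StrictMono (H s)

/-- The weight of a path family up to time `t`. -/
def pastWeight (t : Fin (P.T + 1)) (H : Trajectory P.N P.T) : ℂ :=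
  if P.IsBeginning t H then ∏ s ∈ Finset.Iic t, P.lineWeight (s : ℕ) (H s) else 0

variable {P}

theorem mem_Omega {N S T : ℕ} {ω : Trajectory N T} : ω ∈ Omega N S T ↔ ω ∈ pathFamilies N S T := by
  simp [Omega]

theorem prob_eq (A : Set (Trajectory P.N P.T)) : P.prob A = P.mass A / P.mass Set.univ := by
  simp [prob, mass]

theorem mass_ne_zero {A : Set (Trajectory P.N P.T)} (h : P.prob A ≠ 0) : P.mass A ≠ 0 := by
  rw [prob_eq] at h
  exact (div_ne_zero_iff.mp h).1

theorem condProb_eq {A B : Set (Trajectory P.N P.T)} (h : P.prob B ≠ 0) :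
    P.condProb A B = P.mass (A ∩ B) / P.mass B := by
  rw [prob_eq] at h
  rw [condProb, prob_eq, prob_eq, div_div_div_cancel_right₀ (div_ne_zero_iff.mp h).2]

theorem exists_of_mass_ne_zero {A : Set (Trajectory P.N P.T)} (h : P.mass A ≠ 0) :
    ∃ ω ∈ pathFamilies P.N P.S P.T, ω ∈ A := by
  obtain ⟨ω, hω, -⟩ := Finset.exists_ne_zero_of_sum_ne_zero h
  rw [Finset.mem_filter, mem_Omega] at hω
  exact ⟨ω, hω⟩

theorem mass_empty : P.mass ∅ = 0 := by simp [mass]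

theorem isBeginning_update (t : Fin P.T) (H : Trajectory P.N P.T) (Y : Fin P.N → ℤ) :
    P.IsBeginning t.succ (Function.update H t.succ Y) ↔ P.IsBeginning t.castSucc H ∧
      (∀ k, Y k = H t.castSucc k ∨ Y k = H t.castSucc k + 1) ∧ StrictMono Y := by
  have hne : ∀ s, s ≤ t.castSucc → s ≠ t.succ := fun s hs => (lt_of_le_of_lt hs (by simp)).ne
  have hup : ∀ s, s ≤ t.castSucc → Function.update H t.succ Y s = H s := fun s hs =>
    Function.update_of_ne (hne s hs) _ _
  have h0 : Function.update H t.succ Y 0 = H 0 := hup 0 (Fin.zero_le _)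
  constructor
  · rintro ⟨h1, h2, h3⟩
    refine ⟨⟨by rwa [h0] at h1, fun s hs k => ?_, fun s hs => ?_⟩, fun k => ?_, ?_⟩
    · have := h2 s (hs.trans t.castSucc_lt_succ.le) k
      rwa [hup _ hs, hup _ (s.castSucc_lt_succ.le.trans hs)] at this
    · have := h3 s (hs.trans t.castSucc_lt_succ.le)
      rwa [hup _ hs] at this
    · have := h2 t le_rfl k
      rwa [hup _ le_rfl, Function.update_self] at this
    · have := h3 t.succ le_rfl
      rwa [Function.update_self] at this
  · rintro ⟨⟨h1, h2, h3⟩, h4, h5⟩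
    refine ⟨by rwa [h0], fun s hs k => ?_, fun s hs => ?_⟩
    · rcases (Fin.succ_le_succ_iff.mp hs).eq_or_lt with rfl | hlt
      · rw [hup _ le_rfl, Function.update_self]
        exact h4 k
      · have hs' : s.succ ≤ t.castSucc := Fin.succ_le_castSucc_iff.mpr hlt
        rw [hup _ hs', hup _ (s.castSucc_lt_succ.le.trans hs')]
        exact h2 s hs' k
    · rcases hs.eq_or_lt with rfl | hlt
      · rwa [Function.update_self]
      · have hs' : s ≤ t.castSucc := Fin.le_castSucc_iff.mpr hlt
        rw [hup _ hs']
        exact h3 s hs'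

theorem pastWeight_update (t : Fin P.T) (H : Trajectory P.N P.T) (Y : Fin P.N → ℤ) :
    P.pastWeight t.succ (Function.update H t.succ Y) =
      P.pastWeight t.castSucc H * P.stepWeight (t.succ : ℕ) (H t.castSucc) Y := by
  unfold pastWeight stepWeight
  by_cases h1 : P.IsBeginning t.castSucc H
  swap
  · rw [if_neg h1, if_neg fun h => h1 ((isBeginning_update t H Y).mp h).1, zero_mul]
  by_cases h2 : (∀ k, Y k = H t.castSucc k ∨ Y k = H t.castSucc k + 1) ∧ StrictMono Y
  swap
  · rw [if_neg h2, if_neg fun h => h2 ((isBeginning_update t H Y).mp h).2, mul_zero]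
  rw [if_pos h1, if_pos h2, if_pos ((isBeginning_update t H Y).mpr ⟨h1, h2⟩)]
  have hI : Finset.Iic t.succ = insert t.succ (Finset.Iic t.castSucc) := by
    ext s
    rw [Finset.mem_Iic, Finset.mem_insert, Finset.mem_Iic, Fin.le_castSucc_iff, le_iff_eq_or_lt]
  rw [hI, Finset.prod_insert (by simp), Function.update_self, mul_comm]
  congr 1
  refine Finset.prod_congr rfl fun s hs => ?_
  rw [Function.update_of_ne]
  exact (lt_of_le_of_lt (Finset.mem_Iic.mp hs) (by simp)).ne

theorem mem_past_update {t : Fin P.T} {H ω : Trajectory P.N P.T} {Y : Fin P.N → ℤ} :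
    ω ∈ P.past t.succ (Function.update H t.succ Y) ↔
      ω ∈ P.past t.castSucc H ∧ ω t.succ = Y := by
  constructor
  · intro h
    refine ⟨fun s hs => ?_, by simpa using h t.succ le_rfl⟩
    rw [h s (hs.trans t.castSucc_lt_succ.le), Function.update_of_ne]
    exact (lt_of_le_of_lt hs (by simp)).ne
  · rintro ⟨h, rfl⟩ s hs
    rcases hs.eq_or_lt with rfl | hlt
    · rw [Function.update_self]
    · rw [Function.update_of_ne hlt.ne]
      exact h s (Fin.le_castSucc_iff.mpr hlt)

/-- The total weight of all path families with a given past. -/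
theorem mass_past (t : Fin (P.T + 1)) (H : Trajectory P.N P.T) :
    P.mass (P.past t H) = P.pastWeight t H * P.futureWeight t (H t) := by
  induction t using Fin.reverseInduction generalizing H with
  | last =>
    have hmem : H ∈ Omega P.N P.S P.T ↔ P.IsBeginning (Fin.last P.T) H ∧
        ∀ k : Fin P.N, H (Fin.last P.T) k = (P.S : ℤ) + (k : ℤ) := by
      rw [mem_Omega]
      simp only [pathFamilies, IsBeginning, Set.mem_ofPred_eq, Fin.le_last, true_imp_iff]
      tauto
    have hfil : (Omega P.N P.S P.T).filter (fun ω => ω ∈ P.past (Fin.last P.T) H) =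
        if H ∈ Omega P.N P.S P.T then {H} else ∅ := by
      ext ω
      have : ω ∈ P.past (Fin.last P.T) H ↔ ω = H :=
        ⟨fun h => funext fun s => h s (Fin.le_last s), fun h s _ => by rw [h]⟩
      rw [Finset.mem_filter, this]
      split_ifs with h
      · rw [Finset.mem_singleton]
        exact ⟨fun h => h.2, fun h' => ⟨by rwa [h'], h'⟩⟩
      · simp only [Finset.notMem_empty, iff_false]
        rintro ⟨h1, rfl⟩
        exact h h1
    rw [mass, hfil, futureWeight_last, pastWeight]
    have hI : Finset.Iic (Fin.last P.T) = Finset.univ := by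
      ext s; simp [Fin.le_last]
    by_cases h1 : P.IsBeginning (Fin.last P.T) H
    · by_cases h2 : ∀ k : Fin P.N, H (Fin.last P.T) k = (P.S : ℤ) + (k : ℤ)
      · rw [if_pos (hmem.mpr ⟨h1, h2⟩), if_pos h1, if_pos h2, Finset.sum_singleton, mul_one, hI]
        rfl
      · rw [if_neg fun h => h2 (hmem.mp h).2, if_neg h2]
        simp
    · rw [if_neg fun h => h1 (hmem.mp h).1, if_neg h1]
      simp
  | cast t ih =>
    -- Sort the families by the set `J` of particles that jump in the next step; `J` and the
    -- configuration at time `t` determine the next one.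
    rw [futureWeight_castSucc, Finset.mul_sum, mass,
      ← Finset.sum_fiberwise _ (fun ω : Trajectory P.N P.T =>
        Finset.univ.filter fun k => ω t.succ k = ω t.castSucc k + 1)]
    refine Finset.sum_congr rfl fun J _ => ?_
    have h := ih (Function.update H t.succ (jump J (H t.castSucc)))
    rw [pastWeight_update, Function.update_self] at h
    rw [← mul_assoc, ← h, mass]
    congr 1
    ext ω
    rw [Finset.mem_filter, Finset.mem_filter, Finset.mem_filter, mem_past_update, and_assoc]
    refine and_congr_right fun hω => and_congr_right fun hpast => ?_
    have hH : ω t.castSucc = H t.castSucc := hpast _ le_rfl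
    have hstep := (mem_Omega.mp hω).2.2.1 t
    rw [← hH]
    constructor
    · rintro rfl
      funext k
      simp only [jump, Finset.mem_filter, Finset.mem_univ, true_and]
      split_ifs with hk
      · exact hk
      · exact (hstep k).resolve_right hk
    · intro hJ
      ext k
      simp only [Finset.mem_filter, Finset.mem_univ, true_and, hJ, jump]
      split_ifs with hk <;> simp [hk]

theorem mass_atTime_inter_past (t : Fin P.T) (H : Trajectory P.N P.T) (Y : Fin P.N → ℤ) :
    P.mass (P.atTime t.succ Y ∩ P.past t.castSucc H) = P.pastWeight t.castSucc H *
      (P.stepWeight (t.succ : ℕ) (H t.castSucc) Y * P.futureWeight t.succ Y) := by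
  have h := mass_past t.succ (Function.update H t.succ Y)
  rw [pastWeight_update, Function.update_self] at h
  rw [← mul_assoc, ← h]
  congr 1
  ext ω
  rw [mem_past_update, Set.mem_inter_iff, and_comm]
  rfl

/-- Decomposition of an event according to the past. -/
theorem mass_eq_sum_past (t : Fin (P.T + 1)) :
    ∃ E : Finset (Trajectory P.N P.T), ∀ A : Set (Trajectory P.N P.T),
      P.mass A = ∑ H ∈ E, P.mass (A ∩ P.past t H) := by
  -- Erasing everything after time `t` gives one representative for each possible past, so the
  -- finitely many events `past t H` partition the path families.
  let g : Trajectory P.N P.T → Trajectory P.N P.T := fun ω s => if s ≤ t then ω s else 0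
  refine ⟨(Omega P.N P.S P.T).image g, fun A => ?_⟩
  have hmaps : ∀ ω ∈ (Omega P.N P.S P.T).filter (fun ω => ω ∈ A),
      g ω ∈ (Omega P.N P.S P.T).image g := fun ω hω =>
    Finset.mem_image_of_mem _ (Finset.mem_filter.mp hω).1
  rw [mass, ← Finset.sum_fiberwise_of_maps_to hmaps]
  refine Finset.sum_congr rfl fun H hH => ?_
  obtain ⟨ω₀, -, rfl⟩ := Finset.mem_image.mp hH
  refine Finset.sum_congr (Finset.ext fun ω => ?_) fun _ _ => rfl
  simp only [Finset.mem_filter, and_assoc, Set.mem_inter_iff]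
  refine and_congr_right fun _ => and_congr_right fun _ => ?_
  constructor
  · intro h s hs
    have := congrFun h s
    simp only [g, if_pos hs] at this ⊢
    exact this
  · intro h
    funext s
    by_cases hs : s ≤ t
    · have := h s hs
      simp only [g, if_pos hs] at this ⊢
      exact this
    · simp only [g, if_neg hs]

theorem atTime_inter_past (t : Fin (P.T + 1)) (X : Fin P.N → ℤ) (H : Trajectory P.N P.T) :
    P.atTime t X ∩ P.past t H = if H t = X then P.past t H else ∅ := by
  split_ifs with h
  · exact Set.inter_eq_right.mpr fun ω hω => (hω t le_rfl).trans h
  · refine Set.eq_empty_of_forall_notMem fun ω hω => h ?_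
    exact (hω.2 t le_rfl).symm.trans hω.1

/-- Holds for each past separately and then by summation. The cross-multiplied form is needed since
complex weights may sum to zero. -/
theorem mass_atTime_mul (t : Fin P.T) (X Y : Fin P.N → ℤ) :
    P.mass (P.atTime t.succ Y ∩ P.atTime t.castSucc X) * P.futureWeight t.castSucc X =
      P.stepWeight (t.succ : ℕ) X Y * P.futureWeight t.succ Y *
        P.mass (P.atTime t.castSucc X) := by
  obtain ⟨E, hE⟩ := mass_eq_sum_past (P := P) t.castSucc
  rw [hE (_ ∩ _), hE (P.atTime t.castSucc X), Finset.sum_mul, Finset.mul_sum]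
  refine Finset.sum_congr rfl fun H _ => ?_
  rw [Set.inter_assoc, atTime_inter_past]
  split_ifs with h
  · subst h
    rw [mass_atTime_inter_past, mass_past]
    ring
  · simp [mass_empty]

/-- Every past through `X` has this future weight as a factor of its mass, so its vanishing would
make the whole event have mass zero. -/
theorem futureWeight_ne_zero {t : Fin P.T} {X : Fin P.N → ℤ}
    (h : P.prob (P.atTime t.castSucc X) ≠ 0) : P.futureWeight t.castSucc X ≠ 0 := by
  have hm := mass_ne_zero h
  obtain ⟨E, hE⟩ := mass_eq_sum_past (P := P) t.castSucc
  rw [hE] at hm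
  obtain ⟨H, -, hH⟩ := Finset.exists_ne_zero_of_sum_ne_zero hm
  rw [atTime_inter_past] at hH
  split_ifs at hH with hX
  · subst hX
    rw [mass_past] at hH
    exact right_ne_zero_of_mul hH
  · exact absurd mass_empty hH

theorem condProb_atTime {t : Fin P.T} {X : Fin P.N → ℤ}
    (h : P.prob (P.atTime t.castSucc X) ≠ 0) (Y : Fin P.N → ℤ) :
    P.condProb (P.atTime t.succ Y) (P.atTime t.castSucc X) =
      P.stepWeight (t.succ : ℕ) X Y * P.futureWeight t.succ Y / P.futureWeight t.castSucc X := by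
  rw [condProb_eq h, div_eq_div_iff (mass_ne_zero h) (futureWeight_ne_zero h), mass_atTime_mul]

theorem condProb_past {t : Fin P.T} {H : Trajectory P.N P.T}
    (h : P.prob (P.past t.castSucc H) ≠ 0) (Y : Fin P.N → ℤ) :
    P.condProb (P.atTime t.succ Y) (P.past t.castSucc H) =
      P.stepWeight (t.succ : ℕ) (H t.castSucc) Y * P.futureWeight t.succ Y /
        P.futureWeight t.castSucc (H t.castSucc) := by
  have hm := mass_ne_zero h
  rw [mass_past] at hm
  rw [condProb_eq h, mass_atTime_inter_past, mass_past,
    mul_div_mul_left _ _ (left_ne_zero_of_mul hm)]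

/-- The process is a Markov chain. -/
theorem condProb_past_eq_condProb_atTime {t : Fin P.T} {H : Trajectory P.N P.T}
    (h : P.prob (P.past t.castSucc H) ≠ 0)
    (h' : P.prob (P.atTime t.castSucc (H t.castSucc)) ≠ 0) (Y : Fin P.N → ℤ) :
    P.condProb (P.atTime t.succ Y) (P.past t.castSucc H) =
      P.condProb (P.atTime t.succ Y) (P.atTime t.castSucc (H t.castSucc)) := by
  rw [condProb_past h, condProb_atTime h']

end Params

namespace Params

/-! ### Transition probabilities -/

variable (P : Params)

/-- The elliptic Vandermonde product on the line `t`. -/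
def vandermonde (t : ℤ) (X : Fin P.N → ℤ) : ℂ :=
  ∏ k, ∏ l ∈ Finset.Ioi k, P.phi t (X k) (X l)

/-- The factor of a particle that arrives at the site `x` of the line `t`. -/
def arrivalWeight (t x : ℤ) : ℂ :=
  (∏ m ∈ Finset.Ico x (min (t + P.N - 1) (P.S + P.N - 1)), P.w₁ (t - 1) m / P.w₀ (t - 1) m)⁻¹

/-- The factor of a particle that departs from the site `x` of the line `t`. -/
def departureWeight (t x : ℤ) : ℂ :=
  if x ∈ sites P.N P.S P.T (t + 1) then P.arrivalWeight (t + 1) x / P.w₀ t x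
  else P.arrivalWeight (t + 1) (x + 1) / P.w₁ t x

/-- Configurations of particles on the line `t`. -/
def IsConfiguration (t : ℤ) (X : Fin P.N → ℤ) : Prop :=
  StrictMono X ∧ ∀ k, X k ∈ sites P.N P.S P.T t

variable {P}

theorem mem_sites_pred {N S T : ℕ} {t x : ℤ} (hx : x ∈ sites N S T t)
    (hx' : x + 1 ∈ sites N S T t) : x ∈ sites N S T (t - 1) := by
  rw [mem_sites] at *
  omega

theorem Generic.w_pred_ne (hP : P.Generic) {t x : ℤ} (ht : 0 < t) (htT : t ≤ P.T)
    (hx : x ∈ sites P.N P.S P.T t) (hx' : x + 1 ∈ sites P.N P.S P.T t) :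
    P.w₀ (t - 1) x ≠ 0 ∧ P.w₁ (t - 1) x ≠ 0 :=
  ⟨hP.w₀_ne (by omega) (by omega) (mem_sites_pred hx hx') (by rwa [sub_add_cancel]),
    hP.w₁_ne (by omega) (by omega) (mem_sites_pred hx hx') (by rwa [sub_add_cancel])⟩

theorem Generic.arrivalWeight_ne (hP : P.Generic) {t x : ℤ} (ht : 0 < t) (htT : t ≤ P.T)
    (hx : x ∈ sites P.N P.S P.T t) : P.arrivalWeight t x ≠ 0 := by
  refine inv_ne_zero (Finset.prod_ne_zero_iff.mpr fun m hm => ?_)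
  rw [Finset.mem_Ico] at hm
  rw [mem_sites] at hx
  have h := hP.w_pred_ne ht htT (x := m) (mem_sites.mpr (by omega)) (mem_sites.mpr (by omega))
  exact div_ne_zero h.2 h.1

theorem Generic.arrivalWeight_succ (hP : P.Generic) {t x : ℤ} (ht : 0 < t) (htT : t ≤ P.T)
    (hx : x ∈ sites P.N P.S P.T t) (hx' : x + 1 ∈ sites P.N P.S P.T t) :
    P.arrivalWeight t (x + 1) * P.w₀ (t - 1) x = P.arrivalWeight t x * P.w₁ (t - 1) x := by
  obtain ⟨h0, h1⟩ := hP.w_pred_ne ht htT hx hx'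
  rw [mem_sites] at hx'
  have hI : Finset.Ico x (min (t + P.N - 1) (P.S + P.N - 1)) =
      insert x (Finset.Ico (x + 1) (min (t + P.N - 1) (P.S + P.N - 1))) := by
    ext m
    rw [Finset.mem_insert, Finset.mem_Ico, Finset.mem_Ico]
    omega
  rw [arrivalWeight, arrivalWeight, hI, Finset.prod_insert (by simp), mul_inv, inv_div]
  field_simp

theorem Generic.arrivalWeight_stay (hP : P.Generic) {t x : ℤ} (ht : 0 ≤ t) (htT : t < P.T)
    (hx : x ∈ sites P.N P.S P.T t) (hx' : x ∈ sites P.N P.S P.T (t + 1)) :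
    P.arrivalWeight (t + 1) x = P.w₀ t x * P.departureWeight t x := by
  have h := hP.w₀_ne ht htT hx hx'
  rw [departureWeight, if_pos hx']
  field_simp

/-- With the staying case, this shows that the arrival weights act as a gauge: successive values
have ratio `w₁ / w₀`, so jumping and staying leave the same factor, depending only on the departure
site. If `x` is not a site of the next line, only the jump defines that factor. -/
theorem Generic.arrivalWeight_jump (hP : P.Generic) {t x : ℤ} (ht : 0 ≤ t) (htT : t < P.T)
    (hx : x ∈ sites P.N P.S P.T t) (hx' : x + 1 ∈ sites P.N P.S P.T (t + 1)) :
    P.arrivalWeight (t + 1) (x + 1) = P.w₁ t x * P.departureWeight t x := by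
  rw [departureWeight]
  split_ifs with h
  · have h0 := hP.w₀_ne ht htT hx h
    have := hP.arrivalWeight_succ (t := t + 1) (by omega) (by omega) h hx'
    rw [add_sub_cancel_right] at this
    rw [mul_div_assoc', mul_comm (P.w₁ t x), ← this]
    field_simp
  · have h1 := hP.w₁_ne ht htT hx hx'
    field_simp

/-- Both sides have the same ratio at neighbouring sites, which is `w_mul_lozengeWeight`; the
constant is read off at the lowest site. This identity lets the product form of the future weight
survive from one line to the preceding one. -/
theorem Generic.departureWeight_eq (hP : P.Generic) {t : ℤ} (ht : 0 < t) (htT : t < P.T) :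
    ∃ C : ℂ, ∀ x ∈ sites P.N P.S P.T t, P.departureWeight t x =
      C * P.lozengeWeight t (2 * (x + 1) - t) * P.arrivalWeight t x := by
  have hstep : ∀ x, x ∈ sites P.N P.S P.T t → x + 1 ∈ sites P.N P.S P.T t →
      P.departureWeight t (x + 1) *
        (P.lozengeWeight t (2 * (x + 1) - t) * P.arrivalWeight t x) =
      P.departureWeight t x *
        (P.lozengeWeight t (2 * (x + 1 + 1) - t) * P.arrivalWeight t (x + 1)) := by
    intro x hx hx'
    have hs : x + 1 ∈ sites P.N P.S P.T (t + 1) := by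
      rw [mem_sites] at *
      omega
    have e1 := hP.arrivalWeight_jump ht.le htT hx hs
    have e2 := hP.arrivalWeight_stay ht.le htT hx' hs
    have e3 := hP.w_mul_lozengeWeight ht htT hx hx'
    have e4 := hP.arrivalWeight_succ ht htT.le hx hx'
    have n1 := (hP.w_pred_ne ht htT.le hx hx').2
    have n2 := hP.w₀_ne ht.le htT hx' hs
    rw [e1] at e2
    refine mul_left_cancel₀ (mul_ne_zero n1 n2) ?_
    linear_combination
      -(P.w₁ (t - 1) x * P.lozengeWeight t (2 * (x + 1) - t) * P.arrivalWeight t x) * e2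
      - P.w₁ t x * P.departureWeight t x * P.lozengeWeight t (2 * (x + 1) - t) * e4
      + P.departureWeight t x * P.arrivalWeight t (x + 1) * e3
  have hne : ∀ x ∈ sites P.N P.S P.T t,
      P.lozengeWeight t (2 * (x + 1) - t) * P.arrivalWeight t x ≠ 0 := fun x hx =>
    mul_ne_zero (hP.lozengeWeight_ne ht htT hx) (hP.arrivalWeight_ne ht htT.le hx)
  set a : ℤ := max 0 (t + P.S - P.T) with ha
  refine ⟨P.departureWeight t a /
    (P.lozengeWeight t (2 * (a + 1) - t) * P.arrivalWeight t a), fun x hx => ?_⟩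
  have hax : a ≤ x := by
    rw [mem_sites] at hx
    omega
  rw [mul_assoc]
  induction x, hax using Int.leInduction with
  | base => rw [div_mul_cancel₀ _ (hne a hx)]
  | succ x hax ih =>
    have hx' : x ∈ sites P.N P.S P.T t := by
      rw [mem_sites] at *
      omega
    have h := hstep x hx' hx
    rw [ih hx'] at h
    refine mul_right_cancel₀ (hne x hx') (h.trans ?_)
    ring

/-- Trades the product over holes for one over particles: together they exhaust the sites of the
line. -/
theorem lineWeight_mul_prod {t : ℤ} {X : Fin P.N → ℤ} (hX : P.IsConfiguration t X) :
    P.lineWeight t X * ∏ k, P.lozengeWeight t (2 * (X k + 1) - t) =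
      ∏ x ∈ sites P.N P.S P.T t, P.lozengeWeight t (2 * (x + 1) - t) := by
  have hsub : Finset.univ.image X ⊆ sites P.N P.S P.T t := by
    intro x hx
    obtain ⟨k, -, rfl⟩ := Finset.mem_image.mp hx
    exact hX.2 k
  rw [← Finset.prod_sdiff hsub, Finset.prod_image fun _ _ _ _ h => hX.1.injective h]
  rfl

theorem add_le_of_strictMono {N : ℕ} {X : Fin N → ℤ} (hX : StrictMono X) (d : ℕ) :
    ∀ k l : Fin N, (l : ℕ) = k + d → X k + d ≤ X l := by
  induction d with
  | zero =>
    intro k l h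
    rw [show l = k from Fin.ext (by simpa using h)]
    simp
  | succ d ih =>
    intro k l h
    have h1 := ih k ⟨k + d, by omega⟩ rfl
    have h2 := hX (show (⟨k + d, by omega⟩ : Fin N) < l from by rw [Fin.lt_def]; simp; omega)
    push_cast
    omega

theorem eq_of_isConfiguration_last {X : Fin P.N → ℤ} (hX : P.IsConfiguration P.T X)
    (k : Fin P.N) : X k = (P.S : ℤ) + (k : ℤ) := by
  have hk := k.isLt
  have h1 := add_le_of_strictMono hX.1 k ⟨0, by omega⟩ k (by simp)
  have h2 := add_le_of_strictMono hX.1 (P.N - 1 - k) k ⟨P.N - 1, by omega⟩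
    (by simp; omega)
  have h3 := mem_sites.mp (hX.2 ⟨0, by omega⟩)
  have h4 := mem_sites.mp (hX.2 ⟨P.N - 1, by omega⟩)
  have h5 : ((P.N - 1 - k : ℕ) : ℤ) = P.N - 1 - k := by omega
  omega

/-- A particle must still be able to reach its endpoint. Hence configurations outside the hexagon
contribute nothing to the recursion. -/
theorem bounds_of_futureWeight_ne_zero {t : Fin (P.T + 1)} {X : Fin P.N → ℤ}
    (h : P.futureWeight t X ≠ 0) (k : Fin P.N) :
    (P.S : ℤ) + k - (P.T - (t : ℕ)) ≤ X k ∧ X k ≤ (P.S : ℤ) + k := by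
  induction t using Fin.reverseInduction generalizing X with
  | last =>
    rw [futureWeight_last] at h
    have := (ite_ne_right_iff.mp h).1 k
    rw [this, Fin.val_last]
    omega
  | cast t ih =>
    rw [futureWeight_castSucc] at h
    obtain ⟨J, -, hJ⟩ := Finset.exists_ne_zero_of_sum_ne_zero h
    have h1 := ih (right_ne_zero_of_mul hJ)
    simp only [jump, Fin.val_succ, Fin.val_castSucc] at h1 ⊢
    push_cast at h1
    split_ifs at h1 <;> omega

theorem isConfiguration_of_mem {ω : Trajectory P.N P.T} (hω : ω ∈ pathFamilies P.N P.S P.T)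
    (t : Fin (P.T + 1)) : P.IsConfiguration (t : ℕ) (ω t) := by
  obtain ⟨h1, h2, h3, h4⟩ := hω
  refine ⟨h4 t, fun k => ?_⟩
  have hk := k.isLt
  have hl : (k : ℤ) ≤ ω t k ∧ ω t k ≤ k + (t : ℕ) := by
    induction t using Fin.induction with
    | zero => simp [h1]
    | succ t ih =>
      have := h3 t k
      simp only [Fin.val_succ, Fin.val_castSucc] at ih ⊢
      push_cast
      omega
  have hr : (P.S : ℤ) + k - (P.T - (t : ℕ)) ≤ ω t k ∧ ω t k ≤ (P.S : ℤ) + k := by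
    clear hl
    induction t using Fin.reverseInduction with
    | last => simp [h2]
    | cast t ih =>
      have := h3 t k
      simp only [Fin.val_succ, Fin.val_castSucc] at ih ⊢
      push_cast at ih
      omega
  rw [mem_sites]
  omega

theorem phi_self (hP : P.Generic) (t x : ℤ) : P.phi t x x = 0 := by
  rw [phi, sub_self, zpow_zero, theta_one hP.norm_p]
  ring

/-- Starting from distinct ordered sites, order can fail after one step only through a collision,
where `phi` vanishes. The sum in `sum_vandermonde` may thus run over all `J`. -/
theorem vandermonde_jump_eq_zero (hP : P.Generic) {X : Fin P.N → ℤ} (hX : StrictMono X)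
    {J : Finset (Fin P.N)} (hJ : ¬ StrictMono (jump J X)) (t : ℤ) :
    P.vandermonde t (jump J X) = 0 := by
  simp only [StrictMono, not_forall, not_lt] at hJ
  obtain ⟨k, l, hkl, h⟩ := hJ
  have hlt := hX hkl
  have heq : jump J X k = jump J X l := by
    simp only [jump] at h ⊢
    split_ifs at h ⊢ <;> omega
  refine Finset.prod_eq_zero (Finset.mem_univ k) (Finset.prod_eq_zero (Finset.mem_Ioi.mpr hkl) ?_)
  rw [heq, phi_self hP]

/-- The product of the one-particle weights of a transition. -/
def jumpWeight (P : Params) (t : ℤ) (J : Finset (Fin P.N)) (X : Fin P.N → ℤ) : ℂ :=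
  ∏ k, if k ∈ J then P.w₁ t (X k) else P.w₀ t (X k)

/-- A particle can leave the hexagon only by jumping at the top or staying at the bottom; there `w₁`
or `w₀` contains the factor `θ(1) = 0`. -/
theorem jumpWeight_eq_zero (hP : P.Generic) {t : ℤ} {X : Fin P.N → ℤ} {J : Finset (Fin P.N)}
    {k : Fin P.N} (hX : X k ∈ sites P.N P.S P.T t)
    (hY : jump J X k ∉ sites P.N P.S P.T (t + 1)) : P.jumpWeight t J X = 0 := by
  refine Finset.prod_eq_zero (Finset.mem_univ k) ?_
  rw [mem_sites] at hX hY
  simp only [jump] at hY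
  split_ifs at hY ⊢
  · have : X k + 1 - P.N - P.S = 0 := by omega
    rw [w₁, this, zpow_zero, theta_one hP.norm_p]
    simp
  · have : X k + P.T - t - P.S = 0 := by omega
    rw [w₀, this, zpow_zero, theta_one hP.norm_p]
    simp

/-- The weight of a transition followed by all continuations, given the weights after the
transition. -/
theorem Generic.stepWeight_mul_futureWeight (hP : P.Generic) {t : Fin P.T} {K : ℂ}
    (hK : ∀ Y : Fin P.N → ℤ, P.IsConfiguration ((t : ℕ) + 1) Y →
      P.lineWeight ((t : ℕ) + 1) Y * P.futureWeight t.succ Y =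
        K * (P.vandermonde ((t : ℕ) + 1) Y * ∏ k, P.arrivalWeight ((t : ℕ) + 1) (Y k)))
    {X : Fin P.N → ℤ} (hX : P.IsConfiguration (t : ℕ) X) (J : Finset (Fin P.N)) :
    P.stepWeight (t.succ : ℕ) X (jump J X) * P.futureWeight t.succ (jump J X) =
      K * (P.jumpWeight (t : ℕ) J X * P.vandermonde ((t : ℕ) + 1) (jump J X)) *
        ∏ k, P.departureWeight (t : ℕ) (X k) := by
  have hcast : ((t.succ : ℕ) : ℤ) = (t : ℕ) + 1 := by simp
  have ht : (0 : ℤ) ≤ (t : ℕ) := by omega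
  have htT : ((t : ℕ) : ℤ) < P.T := by have := t.isLt; omega
  rw [hcast, stepWeight]
  by_cases hmono : StrictMono (jump J X)
  swap
  · rw [if_neg fun h => hmono h.2, vandermonde_jump_eq_zero hP hX.1 hmono]
    ring
  have hstep : ∀ k, jump J X k = X k ∨ jump J X k = X k + 1 := fun k => by
    simp only [jump]
    split_ifs <;> simp
  rw [if_pos ⟨hstep, hmono⟩]
  by_cases hsites : ∀ k, jump J X k ∈ sites P.N P.S P.T ((t : ℕ) + 1)
  · have hw : ∏ k, P.arrivalWeight ((t : ℕ) + 1) (jump J X k) =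
        P.jumpWeight (t : ℕ) J X * ∏ k, P.departureWeight (t : ℕ) (X k) := by
      rw [jumpWeight, ← Finset.prod_mul_distrib]
      refine Finset.prod_congr rfl fun k _ => ?_
      have h := hsites k
      simp only [jump] at h ⊢
      split_ifs at h ⊢
      · exact hP.arrivalWeight_jump ht htT (hX.2 k) h
      · exact hP.arrivalWeight_stay ht htT (hX.2 k) h
    rw [hK _ ⟨hmono, hsites⟩, hw]
    ring
  · obtain ⟨k, hk⟩ := not_forall.mp hsites
    rw [jumpWeight_eq_zero hP (hX.2 k) hk]
    -- When a particle leaves the sites, the left side vanishes too, as its endpoint is out of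
    -- reach.
    have hF : P.futureWeight t.succ (jump J X) = 0 := by
      by_contra hne
      have hb := bounds_of_futureWeight_ne_zero hne k
      rw [hcast] at hb
      have h1 := mem_sites.mp (hX.2 k)
      have h2 := hstep k
      have h3 := k.isLt
      refine hk (mem_sites.mpr ?_)
      omega
    rw [hF]
    ring

/-- `κ` is the constant of `sum_vandermonde`. It is chosen before `K`, hence independent of the
normalization on the next line. -/
theorem Generic.futureWeight_castSucc_eq (hP : P.Generic) (t : Fin P.T) :
    ∃ κ : ℂ, ∀ K : ℂ, (∀ Y : Fin P.N → ℤ, P.IsConfiguration ((t : ℕ) + 1) Y →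
      P.lineWeight ((t : ℕ) + 1) Y * P.futureWeight t.succ Y =
        K * (P.vandermonde ((t : ℕ) + 1) Y * ∏ k, P.arrivalWeight ((t : ℕ) + 1) (Y k))) →
    ∀ X : Fin P.N → ℤ, P.IsConfiguration (t : ℕ) X →
      P.futureWeight t.castSucc X =
        K * (κ * P.vandermonde (t : ℕ) X) * ∏ k, P.departureWeight (t : ℕ) (X k) := by
  obtain ⟨κ, hκ⟩ := hP.sum_vandermonde (t := (t : ℕ)) (by omega) (by have := t.isLt; omega)
  refine ⟨κ, fun K hK X hX => ?_⟩
  rw [futureWeight_castSucc, vandermonde, ← hκ X hX.2, Finset.mul_sum, Finset.sum_mul]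
  exact Finset.sum_congr rfl fun J _ => hP.stepWeight_mul_futureWeight hK hX J

/-- The total weight of the tilings to the right of a line factorizes. -/
theorem Generic.lineWeight_mul_futureWeight (hP : P.Generic) (t : Fin (P.T + 1)) (ht : t ≠ 0) :
    ∃ K : ℂ, ∀ Y : Fin P.N → ℤ, P.IsConfiguration (t : ℕ) Y →
      P.lineWeight (t : ℕ) Y * P.futureWeight t Y =
        K * (P.vandermonde (t : ℕ) Y * ∏ k, P.arrivalWeight (t : ℕ) (Y k)) := by
  have hS := hP.S_le_T
  induction t using Fin.reverseInduction with
  | last =>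
    rw [Fin.val_last]
    let Y₀ : Fin P.N → ℤ := fun k => (P.S : ℤ) + (k : ℤ)
    have hT : (0 : ℤ) < P.T := by
      have : (Fin.last P.T : ℕ) ≠ 0 := fun h => ht (Fin.ext h)
      rw [Fin.val_last] at this
      omega
    -- Only the packed configuration fits on the last line, so any non-zero right side can be
    -- matched by choosing `K`.
    refine ⟨P.lineWeight P.T Y₀ * P.futureWeight (Fin.last P.T) Y₀ /
      (P.vandermonde P.T Y₀ * ∏ k, P.arrivalWeight P.T (Y₀ k)), fun Y hY => ?_⟩
    obtain rfl : Y = Y₀ := funext fun k => eq_of_isConfiguration_last hY k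
    refine (div_mul_cancel₀ _ (mul_ne_zero ?_ ?_)).symm
    · refine Finset.prod_ne_zero_iff.mpr fun k _ => Finset.prod_ne_zero_iff.mpr fun l hl => ?_
      have hkl := Finset.mem_Ioi.mp hl
      rw [Fin.lt_def] at hkl
      have hl' := l.isLt
      simp only [Y₀, phi]
      refine mul_ne_zero (mul_ne_zero (zpow_ne_zero _ hP.q_ne) (hP.theta_q_ne ?_ ?_ ?_))
        (hP.theta_v₁v₂ _ ?_ ?_) <;> omega
    · exact Finset.prod_ne_zero_iff.mpr fun k _ => hP.arrivalWeight_ne hT le_rfl (hY.2 k)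
  | cast t ih =>
    obtain ⟨K, hK⟩ := ih (Fin.succ_ne_zero t)
    obtain ⟨κ, hκ⟩ := hP.futureWeight_castSucc_eq t
    have hcast : ((t.succ : ℕ) : ℤ) = (t : ℕ) + 1 := by simp
    rw [hcast] at hK
    have hpos : (0 : ℤ) < (t : ℕ) := by
      have : (t.castSucc : ℕ) ≠ 0 := fun h => ht (Fin.ext h)
      rw [Fin.val_castSucc] at this
      omega
    obtain ⟨C, hC⟩ := hP.departureWeight_eq hpos (by have := t.isLt; omega)
    rw [Fin.val_castSucc]
    refine ⟨K * κ * (∏ _k : Fin P.N, C) *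
      ∏ x ∈ sites P.N P.S P.T (t : ℕ), P.lozengeWeight (t : ℕ) (2 * (x + 1) - (t : ℕ)),
      fun Y hY => ?_⟩
    -- The particle weights produced here combine with the hole weights into the constant product
    -- over all sites.
    have hdep : ∏ k, P.departureWeight (t : ℕ) (Y k) = (∏ _k : Fin P.N, C) *
        (∏ k, P.lozengeWeight (t : ℕ) (2 * (Y k + 1) - (t : ℕ))) *
        ∏ k, P.arrivalWeight (t : ℕ) (Y k) := by
      rw [← Finset.prod_mul_distrib, ← Finset.prod_mul_distrib]
      exact Finset.prod_congr rfl fun k _ => hC _ (hY.2 k)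
    rw [hκ K hK Y hY, hdep, ← lineWeight_mul_prod hY]
    ring

theorem isConfiguration_of_prob_ne_zero {t : Fin (P.T + 1)} {X : Fin P.N → ℤ}
    (h : P.prob (P.atTime t X) ≠ 0) : P.IsConfiguration (t : ℕ) X := by
  obtain ⟨ω, hω, rfl⟩ := exists_of_mass_ne_zero (mass_ne_zero h)
  exact isConfiguration_of_mem hω t

theorem vandermondeRatio_eq (t' t : ℤ) (Y X : Fin P.N → ℤ) :
    P.vandermondeRatio t' t Y X = P.vandermonde t' Y / P.vandermonde t X := by
  simp only [vandermondeRatio, vandermonde, Finset.prod_div_distrib]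

/-- The transition probabilities from the line `t` to the line `t + 1`. -/
theorem Generic.transition (hP : P.Generic) (t : Fin P.T) :
    ∃ c : ℂ, c ≠ 0 ∧ ∀ X Y : Fin P.N → ℤ,
      P.prob (P.atTime t.castSucc X) ≠ 0 →
      (∀ k, Y k - X k = 0 ∨ Y k - X k = 1) →
      P.condProb (P.atTime t.succ Y) (P.atTime t.castSucc X) =
        c * P.vandermondeRatio ((t : ℕ) + 1) (t : ℕ) Y X *
          (∏ k with Y k = X k + 1, P.w₁ (t : ℕ) (X k)) *
          ∏ k with Y k = X k, P.w₀ (t : ℕ) (X k) := by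
  obtain ⟨K, hK⟩ := hP.lineWeight_mul_futureWeight t.succ (Fin.succ_ne_zero t)
  have hcast : ((t.succ : ℕ) : ℤ) = (t : ℕ) + 1 := by simp
  rw [hcast] at hK
  obtain ⟨κ, hκ⟩ := hP.futureWeight_castSucc_eq t
  specialize hκ K hK
  have hconf : ∀ X : Fin P.N → ℤ, P.prob (P.atTime t.castSucc X) ≠ 0 →
      P.IsConfiguration (t : ℕ) X := by
    intro X hX
    have := isConfiguration_of_prob_ne_zero hX
    rwa [Fin.val_castSucc] at this
  -- If `κ = 0`, all future weights on this line vanish; no configuration has non-zero probability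
  -- and any constant will do.
  by_cases hκ0 : κ = 0
  · refine ⟨1, one_ne_zero, fun X Y hX => absurd ?_ (futureWeight_ne_zero hX)⟩
    rw [hκ X (hconf X hX), hκ0]
    ring
  -- `K` and the departure factors occur in both the numerator and `futureWeight`; only `κ` remains.
  refine ⟨κ⁻¹, inv_ne_zero hκ0, fun X Y hX hXY => ?_⟩
  replace hconf := hconf X hX
  have hne := futureWeight_ne_zero hX
  let J : Finset (Fin P.N) := Finset.univ.filter fun k => Y k = X k + 1
  have hY : Y = jump J X := by
    funext k
    have := hXY k
    simp only [jump, J, Finset.mem_filter, Finset.mem_univ, true_and]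
    split_ifs <;> omega
  have hprod : (∏ k with Y k = X k + 1, P.w₁ (t : ℕ) (X k)) *
      ∏ k with Y k = X k, P.w₀ (t : ℕ) (X k) = P.jumpWeight (t : ℕ) J X := by
    rw [jumpWeight, Finset.prod_ite]
    congr 1
    · refine Finset.prod_congr (Finset.ext fun k => ?_) fun _ _ => rfl
      simp [J]
    · refine Finset.prod_congr (Finset.ext fun k => ?_) fun _ _ => rfl
      have := hXY k
      simp only [J, Finset.mem_filter, Finset.mem_univ, true_and]
      omega
  rw [condProb_atTime hX, mul_assoc, hprod, vandermondeRatio_eq]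
  have hstep := hP.stepWeight_mul_futureWeight hK hconf J
  rw [← hY] at hstep
  rw [hκ X hconf] at hne
  rw [hstep, hκ X hconf]
  have n1 : K ≠ 0 := fun h => hne (by rw [h]; ring)
  have n2 : P.vandermonde (t : ℕ) X ≠ 0 := fun h => hne (by rw [h]; ring)
  have n3 := right_ne_zero_of_mul hne
  field_simp

end Params

namespace Params

/-! ### Reflection of the hexagon -/

/-- The parameters of the model after rotating the hexagon by 180 degrees. -/
abbrev reflect (P : Params) : Params where
  N := P.N
  S := P.S
  T := P.T
  p := P.p
  q := P.q
  v₁ := P.q ^ (2 * P.T + P.S - P.N : ℤ) / P.v₁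
  v₂ := P.q ^ (-P.N - P.S - P.T : ℤ) / P.v₂
  rq := P.rq
  -- The sign of the square root compensates the sign from inverting the single theta function in
  -- the numerator of a lozenge weight; the four in the denominator give none.
  rv := -(P.rv⁻¹ * P.rq ^ (P.T - 2 * P.N : ℤ))

/-- The image of a configuration under the rotation. -/
def reflectConf (P : Params) (X : Fin P.N → ℤ) : Fin P.N → ℤ :=
  fun k => P.S + P.N - 1 - X k.rev

/-- The image of a trajectory under the rotation. -/
def reflectTrajectory (P : Params) (ω : Trajectory P.N P.T) : Trajectory P.N P.T :=
  fun t => P.reflectConf (ω t.rev)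

/-- The factor by which the weights change under the rotation. -/
def reflectFactor (P : Params) (t : ℤ) : ℂ := P.q ^ (t - P.N) / (P.v₁ * P.v₂)

variable {P : Params}

theorem reflectConf_reflectConf (X : Fin P.N → ℤ) : P.reflectConf (P.reflectConf X) = X := by
  funext k
  simp [reflectConf]

theorem reflectTrajectory_reflectTrajectory (ω : Trajectory P.N P.T) :
    P.reflectTrajectory (P.reflectTrajectory ω) = ω := by
  funext t
  simp [reflectTrajectory, reflectConf_reflectConf]

theorem reflectConf_eq_iff {X Y : Fin P.N → ℤ} : P.reflectConf X = Y ↔ X = P.reflectConf Y := by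
  constructor
  · rintro rfl
    rw [reflectConf_reflectConf]
  · rintro rfl
    rw [reflectConf_reflectConf]

namespace Generic

/-- Exponents are paired by a fixed sum, equal to the sum of the two bounds in `Generic`. Rotated
theta arguments are thus inverses of original ones within the same range, and genericity is
preserved. -/
theorem reflect_v₁_arg (hP : P.Generic) {m m' : ℤ} (h : m + m' = P.N - P.S - 2 * P.T) :
    P.q ^ m * (P.q ^ (2 * P.T + P.S - P.N : ℤ) / P.v₁) = (P.q ^ m' * P.v₁)⁻¹ := by
  rw [mul_div_assoc', ← zpow_add₀ hP.q_ne, mul_inv, ← zpow_neg, div_eq_mul_inv]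
  congr 2
  omega

theorem reflect_v₂_arg (hP : P.Generic) {m m' : ℤ} (h : m + m' = P.N + P.S + P.T) :
    P.q ^ m * (P.q ^ (-P.N - P.S - P.T : ℤ) / P.v₂) = (P.q ^ m' * P.v₂)⁻¹ := by
  rw [mul_div_assoc', ← zpow_add₀ hP.q_ne, mul_inv, ← zpow_neg, div_eq_mul_inv]
  congr 2
  omega

theorem reflect_v₁v₂_arg (hP : P.Generic) {m m' : ℤ} (h : m + m' = 2 * P.N - P.T) :
    P.q ^ m * ((P.q ^ (2 * P.T + P.S - P.N : ℤ) / P.v₁) *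
      (P.q ^ (-P.N - P.S - P.T : ℤ) / P.v₂)) = (P.q ^ m' * (P.v₁ * P.v₂))⁻¹ := by
  rw [div_mul_div_comm, ← zpow_add₀ hP.q_ne, mul_div_assoc', ← zpow_add₀ hP.q_ne, mul_inv,
    ← zpow_neg, div_eq_mul_inv]
  congr 2
  omega

theorem v₁_arg_ne (hP : P.Generic) (m : ℤ) : P.q ^ m * P.v₁ ≠ 0 :=
  mul_ne_zero (zpow_ne_zero _ hP.q_ne) hP.v₁_ne

theorem v₂_arg_ne (hP : P.Generic) (m : ℤ) : P.q ^ m * P.v₂ ≠ 0 :=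
  mul_ne_zero (zpow_ne_zero _ hP.q_ne) hP.v₂_ne

theorem v₁v₂_arg_ne (hP : P.Generic) (m : ℤ) : P.q ^ m * (P.v₁ * P.v₂) ≠ 0 :=
  mul_ne_zero (zpow_ne_zero _ hP.q_ne) (mul_ne_zero hP.v₁_ne hP.v₂_ne)

theorem reflect (hP : P.Generic) : P.reflect.Generic where
  S_le_T := hP.S_le_T
  norm_p := hP.norm_p
  q_ne := hP.q_ne
  v₁_ne := div_ne_zero (zpow_ne_zero _ hP.q_ne) hP.v₁_ne
  v₂_ne := div_ne_zero (zpow_ne_zero _ hP.q_ne) hP.v₂_ne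
  rq_sq := hP.rq_sq
  rv_sq := by
    have h := hP.reflect_v₁v₂_arg (m := 0) (m' := 2 * P.N - P.T) (by ring)
    rw [zpow_zero, one_mul] at h
    change (-(P.rv⁻¹ * P.rq ^ (P.T - 2 * P.N : ℤ))) ^ 2 = _ / P.v₁ * (_ / P.v₂)
    rw [h, neg_sq, mul_pow, inv_pow, hP.rv_sq, mul_inv (P.q ^ _), ← zpow_neg, neg_sub, hP.q_zpow, mul_comm,
      mul_comm 2 (P.T - 2 * P.N : ℤ), zpow_mul]
    rfl
  theta_q := hP.theta_q
  theta_v₁ := fun m h1 h2 => by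
    change -(2 * (P.T : ℤ)) < m at h1
    change m < (P.N : ℤ) - P.S at h2
    change theta P.p (P.q ^ m * (_ / P.v₁)) ≠ 0
    rw [hP.reflect_v₁_arg (m' := P.N - P.S - 2 * P.T - m) (by ring)]
    exact theta_inv_ne_zero hP.norm_p (hP.v₁_arg_ne _) (hP.theta_v₁ _ (by omega) (by omega))
  theta_v₂ := fun m h1 h2 => by
    change m < (P.N : ℤ) + P.S + P.T at h2
    change theta P.p (P.q ^ m * (_ / P.v₂)) ≠ 0
    rw [hP.reflect_v₂_arg (m' := P.N + P.S + P.T - m) (by ring)]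
    exact theta_inv_ne_zero hP.norm_p (hP.v₂_arg_ne _) (hP.theta_v₂ _ (by omega) (by omega))
  theta_v₁v₂ := fun m h1 h2 => by
    change -(P.T : ℤ) < m at h1
    change m < 2 * (P.N : ℤ) at h2
    change theta P.p (P.q ^ m * (_ / P.v₁ * (_ / P.v₂))) ≠ 0
    rw [hP.reflect_v₁v₂_arg (m' := 2 * P.N - P.T - m) (by ring)]
    exact theta_inv_ne_zero hP.norm_p (hP.v₁v₂_arg_ne _) (hP.theta_v₁v₂ _ (by omega) (by omega))

/-- Rotation inverts all five theta arguments. The product of the four in the denominator is the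
square of the one in the numerator, so the monomials cancel and the weight is exactly invariant. -/
theorem lozengeWeight_reflect (hP : P.Generic) (t x : ℤ) :
    P.reflect.lozengeWeight (P.T - t) (2 * (P.S + P.N - 1 - x + 1) - (P.T - t)) =
      P.lozengeWeight t (2 * (x + 1) - t) := by
  have hp := hP.norm_p
  rw [hP.reflect.lozengeWeight_eq, hP.lozengeWeight_eq]
  dsimp only [Params.reflect]
  rw [hP.reflect_v₁v₂_arg (m' := 2 * x + 1 - t - P.S) (by ring),
    hP.reflect_v₁_arg (m' := x + 1 - 2 * t - P.S) (by ring),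
    hP.reflect_v₁_arg (m' := x - 2 * t - P.S) (by ring),
    hP.reflect_v₂_arg (m' := x + t + 1) (by ring),
    hP.reflect_v₂_arg (m' := x + t) (by ring),
    theta_inv hp (hP.v₁v₂_arg_ne _), theta_inv hp (hP.v₁_arg_ne _), theta_inv hp (hP.v₁_arg_ne _),
    theta_inv hp (hP.v₂_arg_ne _), theta_inv hp (hP.v₂_arg_ne _)]
  have n1 := hP.v₁_arg_ne (x + 1 - 2 * t - P.S)
  have n2 := hP.v₁_arg_ne (x - 2 * t - P.S)
  have n3 := hP.v₂_arg_ne (x + t + 1)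
  have n4 := hP.v₂_arg_ne (x + t)
  have hrq := hP.rq_ne
  have hz : P.rv * P.rq ^ (2 * x + 1 - t - P.S) ≠ 0 :=
    mul_ne_zero hP.rv_ne (zpow_ne_zero _ hrq)
  have hz2 : P.q ^ (2 * x + 1 - t - P.S) * (P.v₁ * P.v₂) =
      (P.rv * P.rq ^ (2 * x + 1 - t - P.S)) ^ 2 := by
    rw [mul_pow, hP.rv_sq, hP.q_zpow, mul_comm 2, zpow_mul, mul_comm]
    rfl
  have hprod : P.q ^ (x + 1 - 2 * t - P.S) * P.v₁ * (P.q ^ (x - 2 * t - P.S) * P.v₁) *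
      (P.q ^ (x + t + 1) * P.v₂) * (P.q ^ (x + t) * P.v₂) =
      (P.rv * P.rq ^ (2 * x + 1 - t - P.S)) ^ 4 := by
    have e : P.q ^ (x + 1 - 2 * t - P.S) * P.q ^ (x - 2 * t - P.S) * P.q ^ (x + t + 1) *
        P.q ^ (x + t) = P.q ^ (2 * x + 1 - t - P.S) * P.q ^ (2 * x + 1 - t - P.S) := by
      simp only [← zpow_add₀ hP.q_ne]
      congr 1
      ring
    rw [show ∀ z : ℂ, z ^ 4 = z ^ 2 * z ^ 2 by intro z; ring, ← hz2]
    linear_combination (P.v₁ * P.v₂) ^ 2 * e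
  have hinv : -(P.rv⁻¹ * P.rq ^ (P.T - 2 * P.N : ℤ)) *
      P.rq ^ (2 * (P.S + P.N - 1 - x) + 1 - (P.T - t) - P.S) =
      -(P.rv * P.rq ^ (2 * x + 1 - t - P.S))⁻¹ := by
    rw [mul_inv, ← zpow_neg, neg_mul, mul_assoc, ← zpow_add₀ hrq]
    congr 3
    ring
  rw [hinv]
  generalize hA : P.q ^ (2 * x + 1 - t - P.S) * (P.v₁ * P.v₂) = A at *
  generalize P.rv * P.rq ^ (2 * x + 1 - t - P.S) = z at *
  generalize P.q ^ (x + 1 - 2 * t - P.S) * P.v₁ = a1 at *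
  generalize P.q ^ (x - 2 * t - P.S) * P.v₁ = a2 at *
  generalize P.q ^ (x + t + 1) * P.v₂ = a3 at *
  generalize P.q ^ (x + t) * P.v₂ = a4 at *
  have key : -z⁻¹ * (-theta P.p A / z ^ 2) * (a1 * a2 * a3 * a4) = z * theta P.p A := by
    rw [hprod]; field_simp
  rw [hz2] at *
  calc _ = (-z⁻¹ * (-theta P.p (z ^ 2) / z ^ 2) * (a1 * a2 * a3 * a4)) /
        (theta P.p a2 * theta P.p a1 * theta P.p a4 * theta P.p a3) := by
          simp only [div_eq_mul_inv, mul_inv, inv_inv, inv_neg]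
          ring
    _ = _ := by rw [key]

theorem theta_quotient_inv {p : ℂ} (hp : ‖p‖ < 1) {a b c d z : ℂ} (ha : a ≠ 0) (hb : b ≠ 0)
    (hc : c ≠ 0) (hd : d ≠ 0) (hz : z ≠ 0) :
    theta p a⁻¹ * theta p b⁻¹ * theta p c⁻¹ * theta p d⁻¹ / theta p z⁻¹ =
      -(z / (a * b * c * d)) * (theta p a * theta p b * theta p c * theta p d / theta p z) := by
  rw [theta_inv hp ha, theta_inv hp hb, theta_inv hp hc, theta_inv hp hd, theta_inv hp hz]
  simp only [div_eq_mul_inv, mul_inv, inv_inv, inv_neg]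
  ring

/-- The factor does not depend on `x` and is the same as for the jump weight in `w₁_reflect`. It
therefore enters the transition formula once per particle, whatever the particle does. -/
theorem w₀_reflect (hP : P.Generic) (t x : ℤ) :
    P.reflect.w₀ (P.T - t) (P.S + P.N - 1 - x) = P.reflectFactor t * P.w₀' t x := by
  have hq := hP.q_ne
  have hv₁ := hP.v₁_ne
  have hv₂ := hP.v₂_ne
  simp only [w₀, w₀', reflectFactor]
  rw [hP.reflect_v₁v₂_arg (m' := x - t - P.S + 1) (by ring),
    hP.reflect_v₁v₂_arg (m' := 2 * x + 1 - t - P.S) (by ring),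
    hP.reflect_v₁_arg (m' := x - t - P.S + 1) (by ring),
    hP.reflect_v₂_arg (m' := x + t) (by ring),
    show P.S + P.N - 1 - x + P.T - (P.T - t) - P.S = -(x - P.N - t + 1) by ring, zpow_neg,
    mul_div_assoc, theta_quotient_inv hP.norm_p (zpow_ne_zero _ hq) (hP.v₁_arg_ne _)
      (hP.v₂_arg_ne _) (hP.v₁v₂_arg_ne _) (hP.v₁v₂_arg_ne _), mul_div_assoc]
  have n1 := hP.v₁_arg_ne (x - t - P.S + 1)
  have n2 := hP.v₂_arg_ne (x + t)
  have n3 := hP.v₁v₂_arg_ne (x - t - P.S + 1)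
  have n4 := zpow_ne_zero (x - P.N - t + 1) hq
  have n5 := hP.v₁v₂_arg_ne (2 * x + 1 - t - P.S)
  have e : P.q ^ (-(P.S + P.N - 1 - x) - P.N + 1) * (P.q ^ (2 * x + 1 - t - P.S) *
      (P.v₁ * P.v₂) / (P.q ^ (x - P.N - t + 1) * (P.q ^ (x - t - P.S + 1) * P.v₁) *
        (P.q ^ (x + t) * P.v₂) * (P.q ^ (x - t - P.S + 1) * (P.v₁ * P.v₂)))) =
      P.q ^ (t - P.N) / (P.v₁ * P.v₂) * P.q ^ (-x) := by
    have e' : P.q ^ (-(P.S + P.N - 1 - x) - P.N + 1) * P.q ^ (2 * x + 1 - t - P.S) =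
        P.q ^ (t - P.N) * P.q ^ (-x) * (P.q ^ (x - P.N - t + 1) * P.q ^ (x - t - P.S + 1) *
          P.q ^ (x + t) * P.q ^ (x - t - P.S + 1)) := by
      simp only [← zpow_add₀ hq]
      congr 1
      ring
    rw [mul_div_assoc', div_mul_eq_mul_div, div_eq_div_iff (by positivity) (by positivity)]
    linear_combination (P.v₁ * P.v₂) ^ 2 * e'
  linear_combination -(theta P.p (P.q ^ (x - P.N - t + 1)) *
    theta P.p (P.q ^ (x - t - P.S + 1) * P.v₁) * theta P.p (P.q ^ (x + t) * P.v₂) *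
    theta P.p (P.q ^ (x - t - P.S + 1) * (P.v₁ * P.v₂)) /
    theta P.p (P.q ^ (2 * x + 1 - t - P.S) * (P.v₁ * P.v₂))) * e

theorem w₁_reflect (hP : P.Generic) (t x : ℤ) :
    P.reflect.w₁ (P.T - t) (P.S + P.N - 1 - x) = P.reflectFactor t * P.w₁' t x := by
  have hq := hP.q_ne
  have hv₁ := hP.v₁_ne
  have hv₂ := hP.v₂_ne
  simp only [w₁, w₁', reflectFactor]
  rw [hP.reflect_v₁v₂_arg (m' := x + P.N - P.S) (by ring),
    hP.reflect_v₁v₂_arg (m' := 2 * x + 1 - t - P.S) (by ring),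
    hP.reflect_v₁_arg (m' := x - 2 * t - P.S + 1) (by ring),
    hP.reflect_v₂_arg (m' := x) (by ring),
    show P.S + P.N - 1 - x + 1 - P.N - P.S = -x by ring, zpow_neg _ x,
    mul_div_assoc, theta_quotient_inv hP.norm_p (zpow_ne_zero _ hq) (hP.v₁_arg_ne _)
      (hP.v₂_arg_ne _) (hP.v₁v₂_arg_ne _) (hP.v₁v₂_arg_ne _), mul_div_assoc]
  have n1 := hP.v₁_arg_ne (x - 2 * t - P.S + 1)
  have n2 := hP.v₂_arg_ne x
  have n3 := hP.v₁v₂_arg_ne (x + P.N - P.S)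
  have n4 := zpow_ne_zero x hq
  have n5 := hP.v₁v₂_arg_ne (2 * x + 1 - t - P.S)
  have e : P.q ^ (-(P.S + P.N - 1 - x)) * (P.q ^ (2 * x + 1 - t - P.S) *
      (P.v₁ * P.v₂) / (P.q ^ x * (P.q ^ (x - 2 * t - P.S + 1) * P.v₁) *
        (P.q ^ x * P.v₂) * (P.q ^ (x + P.N - P.S) * (P.v₁ * P.v₂)))) =
      P.q ^ (t - P.N) / (P.v₁ * P.v₂) * P.q ^ (-x - P.N + 1) := by
    have e' : P.q ^ (-(P.S + P.N - 1 - x)) * P.q ^ (2 * x + 1 - t - P.S) =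
        P.q ^ (t - P.N) * P.q ^ (-x - P.N + 1) * (P.q ^ x * P.q ^ (x - 2 * t - P.S + 1) *
          P.q ^ x * P.q ^ (x + P.N - P.S)) := by
      simp only [← zpow_add₀ hq]
      congr 1
      ring
    rw [mul_div_assoc', div_mul_eq_mul_div, div_eq_div_iff (by positivity) (by positivity)]
    linear_combination (P.v₁ * P.v₂) ^ 2 * e'
  linear_combination (theta P.p (P.q ^ x) *
    theta P.p (P.q ^ (x - 2 * t - P.S + 1) * P.v₁) * theta P.p (P.q ^ x * P.v₂) *
    theta P.p (P.q ^ (x + P.N - P.S) * (P.v₁ * P.v₂)) /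
    theta P.p (P.q ^ (2 * x + 1 - t - P.S) * (P.v₁ * P.v₂))) * e

/-- The exchange of `x` and `y` matches the reversal of the particle labels under the rotation. -/
theorem phi_reflect (hP : P.Generic) (t x y : ℤ) :
    P.reflect.phi (P.T - t) (P.S + P.N - 1 - x) (P.S + P.N - 1 - y) =
      -P.reflectFactor t * P.phi t y x := by
  have hq := hP.q_ne
  have hv₁ := hP.v₁_ne
  have hv₂ := hP.v₂_ne
  simp only [phi, reflectFactor]
  rw [hP.reflect_v₁v₂_arg (m' := y + x + 1 - t - P.S) (by ring),
    theta_inv hP.norm_p (hP.v₁v₂_arg_ne _),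
    show P.S + P.N - 1 - x - (P.S + P.N - 1 - y) = y - x by ring]
  have n := hP.v₁v₂_arg_ne (y + x + 1 - t - P.S)
  have e : P.q ^ (-(P.S + P.N - 1 - x)) / (P.q ^ (y + x + 1 - t - P.S) * (P.v₁ * P.v₂)) =
      P.q ^ (t - P.N) / (P.v₁ * P.v₂) * P.q ^ (-y) := by
    have e' : P.q ^ (-(P.S + P.N - 1 - x)) =
        P.q ^ (t - P.N) * P.q ^ (-y) * P.q ^ (y + x + 1 - t - P.S) := by
      simp only [← zpow_add₀ hq]
      congr 1
      ring
    rw [div_mul_eq_mul_div, div_eq_div_iff n (mul_ne_zero hv₁ hv₂)]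
    linear_combination P.v₁ * P.v₂ * e'
  linear_combination -(theta P.p (P.q ^ (y - x)) *
    theta P.p (P.q ^ (y + x + 1 - t - P.S) * (P.v₁ * P.v₂))) * e

theorem reflectFactor_ne (hP : P.Generic) (t : ℤ) : P.reflectFactor t ≠ 0 :=
  div_ne_zero (zpow_ne_zero _ hP.q_ne) (mul_ne_zero hP.v₁_ne hP.v₂_ne)

end Generic

end Params

/-! ### Transport of probabilities by the rotation, and the co-transition formula -/

namespace Params

variable {P : Params}

theorem mem_holes {t x : ℤ} {X : Fin P.N → ℤ} :
    x ∈ P.holes t X ↔ x ∈ sites P.N P.S P.T t ∧ ∀ k, X k ≠ x := by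
  simp [holes]

theorem reflect_mem_holes {t x : ℤ} {X : Fin P.N → ℤ} (hx : x ∈ P.holes t X) :
    P.S + P.N - 1 - x ∈ P.holes (P.T - t) (P.reflectConf X) := by
  rw [mem_holes, mem_sites] at hx ⊢
  refine ⟨by omega, fun k h => hx.2 k.rev ?_⟩
  simp only [reflectConf] at h
  omega

namespace Generic

theorem lineWeight_reflect (hP : P.Generic) (t : ℤ) (X : Fin P.N → ℤ) :
    P.reflect.lineWeight (P.T - t) (P.reflectConf X) = P.lineWeight t X := by
  refine Finset.prod_nbij' (fun x => P.S + P.N - 1 - x) (fun x => P.S + P.N - 1 - x)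
    (fun x hx => ?_) (fun x hx => reflect_mem_holes hx) (fun x _ => by simp) (fun x _ => by simp)
    fun x _ => ?_
  · have := reflect_mem_holes (P := P) (t := P.T - t) (X := P.reflectConf X) hx
    rwa [reflectConf_reflectConf, sub_sub_cancel] at this
  · have := hP.lozengeWeight_reflect t (P.S + P.N - 1 - x)
    rwa [sub_sub_cancel] at this

theorem tilingWeight_reflect (hP : P.Generic) (ω : Trajectory P.N P.T) :
    P.reflect.tilingWeight (P.reflectTrajectory ω) = P.tilingWeight ω := by
  change ∏ t : Fin (P.T + 1), P.reflect.lineWeight (t : ℕ) (P.reflectConf (ω t.rev)) =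
    ∏ t : Fin (P.T + 1), P.lineWeight (t : ℕ) (ω t)
  rw [← Equiv.prod_comp Fin.revPerm fun t : Fin (P.T + 1) => P.lineWeight (t : ℕ) (ω t)]
  refine Finset.prod_congr rfl fun t _ => ?_
  rw [Fin.revPerm_apply, ← hP.lineWeight_reflect]
  congr 1
  rw [Fin.val_rev]
  have := t.isLt
  omega

end Generic

theorem reflectTrajectory_mem {ω : Trajectory P.N P.T} (hω : ω ∈ pathFamilies P.N P.S P.T) :
    P.reflectTrajectory ω ∈ pathFamilies P.N P.S P.T := by
  obtain ⟨h1, h2, h3, h4⟩ := hω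
  refine ⟨fun k => ?_, fun k => ?_, fun t k => ?_, fun t k l hkl => ?_⟩
  · simp only [reflectTrajectory, reflectConf, Fin.rev_zero, h2, Fin.val_rev]
    have := k.isLt
    omega
  · simp only [reflectTrajectory, reflectConf, Fin.rev_last, h1, Fin.val_rev]
    have := k.isLt
    omega
  · simp only [reflectTrajectory, reflectConf, Fin.rev_succ, Fin.rev_castSucc]
    have := h3 t.rev k.rev
    omega
  · simp only [reflectTrajectory, reflectConf]
    have := h4 t.rev (Fin.rev_lt_rev.mpr hkl)
    omega

namespace Generic

theorem mass_reflect (hP : P.Generic) (A : Set (Trajectory P.N P.T)) :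
    P.reflect.mass (P.reflectTrajectory ⁻¹' A) = P.mass A := by
  refine Finset.sum_nbij' P.reflectTrajectory P.reflectTrajectory (fun ω hω => ?_)
    (fun ω hω => ?_) (fun ω _ => reflectTrajectory_reflectTrajectory ω)
    (fun ω _ => reflectTrajectory_reflectTrajectory ω) fun ω _ => ?_
  · rw [Finset.mem_filter, mem_Omega] at hω ⊢
    exact ⟨reflectTrajectory_mem hω.1, hω.2⟩
  · rw [Finset.mem_filter, mem_Omega] at hω ⊢
    refine ⟨reflectTrajectory_mem hω.1, ?_⟩
    rw [Set.mem_preimage, reflectTrajectory_reflectTrajectory]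
    exact hω.2
  · have := hP.tilingWeight_reflect (P.reflectTrajectory ω)
    rwa [reflectTrajectory_reflectTrajectory] at this

theorem prob_reflect (hP : P.Generic) (A : Set (Trajectory P.N P.T)) :
    P.reflect.prob (P.reflectTrajectory ⁻¹' A) = P.prob A := by
  have h := hP.mass_reflect Set.univ
  rw [Set.preimage_univ] at h
  rw [prob_eq, prob_eq, hP.mass_reflect A]
  exact congrArg _ h

theorem condProb_reflect (hP : P.Generic) (A B : Set (Trajectory P.N P.T)) :
    P.reflect.condProb (P.reflectTrajectory ⁻¹' A) (P.reflectTrajectory ⁻¹' B) =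
      P.condProb A B := by
  have h := hP.prob_reflect (A ∩ B)
  rw [Set.preimage_inter] at h
  rw [condProb, condProb, ← h, ← hP.prob_reflect B]

end Generic

theorem preimage_atTime (t : Fin (P.T + 1)) (X : Fin P.N → ℤ) :
    P.reflectTrajectory ⁻¹' P.atTime t X = P.reflect.atTime t.rev (P.reflectConf X) := by
  ext ω
  exact reflectConf_eq_iff

theorem preimage_future (t : Fin (P.T + 1)) (H : Trajectory P.N P.T) :
    P.reflectTrajectory ⁻¹' P.future t H = P.reflect.past t.rev (P.reflectTrajectory H) := by
  ext ω
  constructor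
  · intro h s hs
    have := reflectConf_eq_iff.mp (h (Fin.rev s) (Fin.le_rev_iff.mpr hs))
    rw [Fin.rev_rev] at this
    exact this
  · intro h s hs
    refine reflectConf_eq_iff.mpr ?_
    have := h (Fin.rev s) (Fin.rev_le_rev.mpr hs)
    rw [this]
    simp only [reflectTrajectory, Fin.rev_rev]

/-- Reversing the labels turns a pair `k < l` into `l.rev < k.rev`, so it permutes the ordered
pairs. -/
theorem prod_Ioi_rev {n : ℕ} (f : Fin n → Fin n → ℂ) :
    ∏ k : Fin n, ∏ l ∈ Finset.Ioi k, f (Fin.rev l) (Fin.rev k) = ∏ k, ∏ l ∈ Finset.Ioi k, f k l := by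
  rw [Finset.prod_sigma', Finset.prod_sigma']
  refine Finset.prod_nbij' (fun a => ⟨a.2.rev, a.1.rev⟩) (fun a => ⟨a.2.rev, a.1.rev⟩)
    ?_ ?_ ?_ ?_ ?_ <;> simp

namespace Generic

theorem vandermonde_reflect (hP : P.Generic) (t : ℤ) (X : Fin P.N → ℤ) :
    P.reflect.vandermonde (P.T - t) (P.reflectConf X) =
      (∏ k : Fin P.N, ∏ _l ∈ Finset.Ioi k, -P.reflectFactor t) * P.vandermonde t X := by
  have h : P.reflect.vandermonde (P.T - t) (P.reflectConf X) =
      ∏ k : Fin P.N, ∏ l ∈ Finset.Ioi k, -P.reflectFactor t * P.phi t (X l.rev) (X k.rev) :=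
    Finset.prod_congr rfl fun k _ => Finset.prod_congr rfl fun l _ =>
      hP.phi_reflect t (X k.rev) (X l.rev)
  rw [h, vandermonde, ← prod_Ioi_rev]
  simp only [Finset.prod_mul_distrib, Fin.rev_rev]

/-- The process is a Markov chain in the reversed direction of time. -/
theorem condProb_future_eq_condProb_atTime (hP : P.Generic) {t : Fin P.T}
    {H : Trajectory P.N P.T} (h : P.prob (P.future t.succ H) ≠ 0)
    (h' : P.prob (P.atTime t.succ (H t.succ)) ≠ 0) (Y : Fin P.N → ℤ) :
    P.condProb (P.atTime t.castSucc Y) (P.future t.succ H) =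
      P.condProb (P.atTime t.castSucc Y) (P.atTime t.succ (H t.succ)) := by
  rw [← hP.prob_reflect, preimage_future, Fin.rev_succ] at h
  rw [← hP.prob_reflect, preimage_atTime, Fin.rev_succ] at h'
  rw [← hP.condProb_reflect, ← hP.condProb_reflect, preimage_future, preimage_atTime,
    preimage_atTime, Fin.rev_succ, Fin.rev_castSucc]
  have e : P.reflectTrajectory H t.rev.castSucc = P.reflectConf (H t.succ) := by
    rw [reflectTrajectory, Fin.rev_castSucc, Fin.rev_rev]
  have := condProb_past_eq_condProb_atTime (P := P.reflect) (t := t.rev)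
    (H := P.reflectTrajectory H) h (by rw [e]; exact h') (P.reflectConf Y)
  rw [e] at this
  exact this

/-- The transition probabilities from the line `t + 1` to the line `t`. -/
theorem cotransition (hP : P.Generic) (t : Fin P.T) :
    ∃ c : ℂ, c ≠ 0 ∧ ∀ X Y : Fin P.N → ℤ,
      P.prob (P.atTime t.succ X) ≠ 0 →
      (∀ k, Y k - X k = 0 ∨ Y k - X k = -1) →
      P.condProb (P.atTime t.castSucc Y) (P.atTime t.succ X) =
        c * P.vandermondeRatio (t : ℕ) ((t : ℕ) + 1) Y X *
          (∏ k with Y k = X k - 1, P.w₁' ((t : ℕ) + 1) (X k)) *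
          ∏ k with Y k = X k, P.w₀' ((t : ℕ) + 1) (X k) := by
  obtain ⟨c, hc, h⟩ := hP.reflect.transition t.rev
  have hD : ∀ s : ℤ, ∏ k : Fin P.N, ∏ _l ∈ Finset.Ioi k, -P.reflectFactor s ≠ 0 := fun s =>
    Finset.prod_ne_zero_iff.mpr fun k _ => Finset.prod_ne_zero_iff.mpr fun _ _ =>
      neg_ne_zero.mpr (hP.reflectFactor_ne s)
  have hC : ∏ _k : Fin P.N, P.reflectFactor ((t : ℕ) + 1) ≠ 0 :=
    Finset.prod_ne_zero_iff.mpr fun _ _ => hP.reflectFactor_ne _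
  -- The constant for the rotated model, corrected by one factor per pair from the two Vandermonde
  -- products and one factor per particle from the weights.
  refine ⟨c * ((∏ k : Fin P.N, ∏ _l ∈ Finset.Ioi k, -P.reflectFactor (t : ℕ)) /
    (∏ k : Fin P.N, ∏ _l ∈ Finset.Ioi k, -P.reflectFactor ((t : ℕ) + 1))) *
    ∏ _k : Fin P.N, P.reflectFactor ((t : ℕ) + 1),
    mul_ne_zero (mul_ne_zero hc (div_ne_zero (hD _) (hD _))) hC, fun X Y hX hXY => ?_⟩
  rw [← hP.prob_reflect, preimage_atTime, Fin.rev_succ] at hX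
  rw [← hP.condProb_reflect, preimage_atTime, preimage_atTime, Fin.rev_succ, Fin.rev_castSucc]
  have ht : ((t.rev : ℕ) : ℤ) = P.T - ((t : ℕ) + 1) := by
    rw [Fin.val_rev]
    have := t.isLt
    omega
  have hXY' : ∀ k, P.reflectConf Y k - P.reflectConf X k = 0 ∨
      P.reflectConf Y k - P.reflectConf X k = 1 := by
    intro k
    have := hXY k.rev
    simp only [reflectConf]
    omega
  refine (h (P.reflectConf X) (P.reflectConf Y) hX hXY').trans ?_
  have hw₁ : ∏ k with P.reflectConf Y k = P.reflectConf X k + 1,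
      P.reflect.w₁ (t.rev : ℕ) (P.reflectConf X k) =
      ∏ k with Y k = X k - 1, P.reflectFactor ((t : ℕ) + 1) * P.w₁' ((t : ℕ) + 1) (X k) := by
    rw [ht]
    refine Finset.prod_nbij' Fin.rev Fin.rev (fun k hk => ?_) (fun k hk => ?_) (by simp) (by simp)
      fun k _ => hP.w₁_reflect _ _
    · have : P.S + P.N - 1 - Y k.rev = P.S + P.N - 1 - X k.rev + 1 := (Finset.mem_filter.mp hk).2
      refine Finset.mem_filter.mpr ⟨Finset.mem_univ _, ?_⟩
      omega
    · have : Y k = X k - 1 := (Finset.mem_filter.mp hk).2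
      refine Finset.mem_filter.mpr ⟨Finset.mem_univ _, ?_⟩
      simp only [reflectConf, Fin.rev_rev]
      omega
  have hw₀ : ∏ k with P.reflectConf Y k = P.reflectConf X k,
      P.reflect.w₀ (t.rev : ℕ) (P.reflectConf X k) =
      ∏ k with Y k = X k, P.reflectFactor ((t : ℕ) + 1) * P.w₀' ((t : ℕ) + 1) (X k) := by
    rw [ht]
    refine Finset.prod_nbij' Fin.rev Fin.rev (fun k hk => ?_) (fun k hk => ?_) (by simp) (by simp)
      fun k _ => hP.w₀_reflect _ _
    · have : P.S + P.N - 1 - Y k.rev = P.S + P.N - 1 - X k.rev := (Finset.mem_filter.mp hk).2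
      refine Finset.mem_filter.mpr ⟨Finset.mem_univ _, ?_⟩
      omega
    · have : Y k = X k := (Finset.mem_filter.mp hk).2
      refine Finset.mem_filter.mpr ⟨Finset.mem_univ _, ?_⟩
      simp only [reflectConf, Fin.rev_rev]
      omega
  -- Every particle either stays or jumps, so the factors multiply to an `N`-fold product
  -- independent of `X` and `Y`.
  have hfac : (∏ k with Y k = X k - 1, P.reflectFactor ((t : ℕ) + 1)) *
      ∏ k with Y k = X k, P.reflectFactor ((t : ℕ) + 1) =
      ∏ _k : Fin P.N, P.reflectFactor ((t : ℕ) + 1) := by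
    rw [← Finset.prod_filter_mul_prod_filter_not Finset.univ fun k => Y k = X k - 1]
    congr 1
    refine Finset.prod_congr (Finset.ext fun k => ?_) fun _ _ => rfl
    have := hXY k
    simp only [Finset.mem_filter, Finset.mem_univ, true_and]
    omega
  have hv : P.reflect.vandermondeRatio ((t.rev : ℕ) + 1) (t.rev : ℕ) (P.reflectConf Y)
      (P.reflectConf X) =
      (∏ k : Fin P.N, ∏ _l ∈ Finset.Ioi k, -P.reflectFactor (t : ℕ)) /
      (∏ k : Fin P.N, ∏ _l ∈ Finset.Ioi k, -P.reflectFactor ((t : ℕ) + 1)) *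
      P.vandermondeRatio (t : ℕ) ((t : ℕ) + 1) Y X := by
    rw [vandermondeRatio_eq, vandermondeRatio_eq, ht,
      show (P.T : ℤ) - ((t : ℕ) + 1) + 1 = P.T - (t : ℕ) by ring]
    rw [div_mul_div_comm]
    exact congrArg₂ (· / ·) (hP.vandermonde_reflect _ _) (hP.vandermonde_reflect _ _)
  rw [hv, ← hfac]
  rw [Finset.prod_mul_distrib] at hw₁ hw₀
  refine (congrArg₂ (fun a b => c * _ * a * b) hw₁ hw₀).trans ?_
  ring

end Generic

end Params

end EllipticTilings

end

theorem mainTheorem5 (P : EllipticTilings.Params) (hP : P.Generic) :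
    -- X(t) is a Markov chain, forwards and backwards in time
    (∀ (t : Fin P.T) (H : EllipticTilings.Trajectory P.N P.T) (Y : Fin P.N → ℤ),
      P.prob (P.past t.castSucc H) ≠ 0 →
      P.prob (P.atTime t.castSucc (H t.castSucc)) ≠ 0 →
      P.condProb (P.atTime t.succ Y) (P.past t.castSucc H) =
        P.condProb (P.atTime t.succ Y) (P.atTime t.castSucc (H t.castSucc))) ∧
    (∀ (t : Fin P.T) (H : EllipticTilings.Trajectory P.N P.T) (Y : Fin P.N → ℤ),
      P.prob (P.future t.succ H) ≠ 0 →
      P.prob (P.atTime t.succ (H t.succ)) ≠ 0 →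
      P.condProb (P.atTime t.castSucc Y) (P.future t.succ H) =
        P.condProb (P.atTime t.castSucc Y) (P.atTime t.succ (H t.succ))) ∧
    -- transition probabilities, from time t to time t + 1, for t = 0, ..., T - 1
    (∀ t : Fin P.T, ∃ c : ℂ, c ≠ 0 ∧ ∀ X Y : Fin P.N → ℤ,
      P.prob (P.atTime t.castSucc X) ≠ 0 →
      (∀ k, Y k - X k = 0 ∨ Y k - X k = 1) →
      P.condProb (P.atTime t.succ Y) (P.atTime t.castSucc X) =
        c * P.vandermondeRatio ((t : ℕ) + 1) (t : ℕ) Y X *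
          (∏ k with Y k = X k + 1, P.w₁ (t : ℕ) (X k)) *
          ∏ k with Y k = X k, P.w₀ (t : ℕ) (X k)) ∧
    -- co-transition probabilities, from time t + 1 to time t, for t + 1 = 1, ..., T
    (∀ t : Fin P.T, ∃ c : ℂ, c ≠ 0 ∧ ∀ X Y : Fin P.N → ℤ,
      P.prob (P.atTime t.succ X) ≠ 0 →
      (∀ k, Y k - X k = 0 ∨ Y k - X k = -1) →
      P.condProb (P.atTime t.castSucc Y) (P.atTime t.succ X) =
        c * P.vandermondeRatio (t : ℕ) ((t : ℕ) + 1) Y X *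
          (∏ k with Y k = X k - 1, P.w₁' ((t : ℕ) + 1) (X k)) *
          ∏ k with Y k = X k, P.w₀' ((t : ℕ) + 1) (X k)) :=
  ⟨fun _ _ Y h h' => EllipticTilings.Params.condProb_past_eq_condProb_atTime h h' Y,
    fun _ _ Y h h' => hP.condProb_future_eq_condProb_atTime h h' Y,
    hP.transition, hP.cotransition⟩
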